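/- **Lemma (Prime power-counting).** Consider the rank 3 tensor model over $U(1)$ in momentum space, with field modes $\varphi_{p}$, $p=(p_1,p_2,p_3)\in\mathbb Z^3$, and covariance $\big(\sum_{s=1}^3 a_s|p_s|+m\big)^{-1}\prod_s\delta_{p_s,p'_s}$, where $a_1,a_2,a_3>0$ and $m>0$. Fix an integer $M\ge 2$ and slice the propagator as $C=\sum_{i\ge 0}C_i$, with $$C_0=\int_1^\infty d\alpha\, e^{-\alpha(\sum_s a_s|p_s|+m)}\prod_s\delta_{p_s,p'_s},\qquad C_i=\int_{M^{-i}}^{M^{-i+1}}d\alpha\, e^{-\alpha(\sum_s a_s|p_s|+m)}\prod_s\delta_{p_s,p'_s}\quad(i\ge1).$$ The vertices are the quartic vertices $\sum\varphi_{p_1,p_2,p_3}\bar\varphi_{p_{1'},p_2,p_3}\varphi_{p_{1'},p_{2'},p_{3'}}\bar\varphi_{p_1,p_{2'},p_{3'}}$ and its two color permutations, the mass vertex $\sum\bar\varphi_p\varphi_p$, and the wave-function vertices $\sum\bar\varphi_p|p_s|\varphi_p$, $s=1,2,3$ (coupling constants removed). A Feynman graph $\mathcal G$ has $n$ such vertices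 and finitely many lines, each joining a $\varphi$-leg to a $\bar\varphi$-leg; the remaining legs are external and amputated. Fix a family of smooth test functions on $U(1)^3$ that is bounded in $C^\infty$ (for example, a finite family). A scale attribution with cutoff $\Lambda$ is a map $\mu:\ell\mapsto i_\ell\in\{0,\dots,\Lambda\}$ on the lines. The amplitude $A_{\mathcal G;\mu}$ is the sum over all momenta of the product of the slices $C_{i_\ell}$ on the lines, the vertex operators, and, at each external leg, a Fourier coefficient of a test function from the family (its complex conjugate at a $\bar\varphi$-leg). For $0\le i\le\Lambda$, let $G_i^k$, $k=1,\dots,k(i)$, be the connected components of the subgraph made of all lines of scale $\ge i$ (each component has at least one line; its vertices are the ends of its lines). For a subgraph $g$ let $$\omega_d(g)=-L(g)+F_{\rm int}(g)+\sum_{s=1}^3V'_{s;2}(g),$$ where $L(g)$ is the number of lines of $g$, $F_{\rm int}(g)$ the number of its internal faces (closed strand lines, i.e. closed faces of $\mathcal G$ all of whose lines lie in $g$), and $V'_{s;2}(g)$ the number of its wave-function vertices of color $s$. Then there is a constant $K>0$, depending only on $M$, $a_1,a_2,a_3$, $m$ and the family of test functions, such that for every connected graph $\mathcal G$ (with $n$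 vertices), every choice of test functions from the family at its external legs, every $\Lambda$ and every scale attribution $\mu$ with cutoff $\Lambda$, the sum defining $A_{\mathcal G;\mu}$ converges absolutely and $$|A_{\mathcal G;\mu}|\le K^{n}\prod_{i=0}^{\Lambda}\ \prod_{k=1}^{k(i)}M^{\omega_d(G_i^k)}.$$ -/

import Mathlib

open scoped BigOperators ContDiff

noncomputable section

namespace TensorModel

/-- The vertices of the rank 3 model: the quartic vertex with distinguished color `c`
(for `c` the first color it is
`∑ φ_{1,2,3} φ̄_{1',2,3} φ_{1',2',3'} φ̄_{1,2',3'}`, the other two are obtained by permuting the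
colors), the mass vertex `∑ φ̄_p φ_p`, and the wave-function vertex `∑ φ̄_p |p_s| φ_p`. -/
inductive VertexKind : Type
  | quartic (c : Fin 3)
  | mass
  | wave (s : Fin 3)

/-- Number of `φ`-legs of a vertex; it is also its number of `φ̄`-legs. -/
def VertexKind.arity : VertexKind → ℕ
  | .quartic _ => 2
  | .mass => 1
  | .wave _ => 1

/-- Inside a vertex, the strand of color `s` of the `φ`-leg `j` is joined to the strand of color
`s` of the `φ̄`-leg `strandPerm k s j`. -/
def VertexKind.strandPerm : (k : VertexKind) → Fin 3 → Equiv.Perm (Fin k.arity)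
  | .quartic c, s => if s = c then (Equiv.swap 0 1 : Equiv.Perm (Fin 2)) else 1
  | .mass, _ => 1
  | .wave _, _ => 1

/-- The factor `|p_s|` of a wave-function vertex; `1` for the other vertices. -/
def VertexKind.weight : (k : VertexKind) → (Fin k.arity → Fin 3 → ℤ) → ℝ
  | .quartic _, _ => 1
  | .mass, _ => 1
  | .wave s, p => |((p (0 : Fin 1) s : ℤ) : ℝ)|

/-- The vertex operator in momentum space (without coupling constant): `p` are the momenta of the
`φ`-legs and `q` those of the `φ̄`-legs. -/
def VertexKind.kernel (k : VertexKind) (p q : Fin k.arity → Fin 3 → ℤ) : ℝ :=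
  k.weight p * ∏ j, ∏ s : Fin 3, if p j s = q (k.strandPerm s j) s then 1 else 0

/-- Feynman graphs of the model, with vertex set `V` and set of (internal) lines `L`. Each line
joins a `φ`-leg to a `φ̄`-leg, and each leg is used by at most one line. The legs that no line uses
are the (amputated) external legs. -/
structure TensorGraph (V L : Type*) where
  kind : V → VertexKind
  phiEnd : L → (v : V) × Fin (kind v).arity
  barEnd : L → (v : V) × Fin (kind v).arity
  phiEnd_injective : Function.Injective phiEnd
  barEnd_injective : Function.Injective barEnd

/-- The slice `C_i` of the propagator `(∑ a_s |p_s| + m)⁻¹`. -/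
def slice (M : ℕ) (a : Fin 3 → ℝ) (m : ℝ) : ℕ → (Fin 3 → ℤ) → ℝ
  | 0, p => ∫ α in Set.Ioi (1 : ℝ), Real.exp (-α * (∑ s, a s * |(p s : ℝ)| + m))
  | i + 1, p => ∫ α in ((M : ℝ)⁻¹ ^ (i + 1))..((M : ℝ)⁻¹ ^ i),
      Real.exp (-α * (∑ s, a s * |(p s : ℝ)| + m))

/-- The kernel `C_i([p_s], [p'_s])`. -/
def propagator (M : ℕ) (a : Fin 3 → ℝ) (m : ℝ) (i : ℕ) (p p' : Fin 3 → ℤ) : ℝ :=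
  slice M a m i p * ∏ s : Fin 3, if p s = p' s then 1 else 0

/-- The periodic function on `ℝ³` that a function on the torus `U(1)³` lifts to. -/
def lift (f : UnitAddTorus (Fin 3) → ℂ) (x : Fin 3 → ℝ) : ℂ :=
  f fun s => (x s : UnitAddCircle)

namespace TensorGraph

variable {V L : Type*} (G : TensorGraph V L)

/-- The `φ`-legs of `G`; the same type also labels its `φ̄`-legs. -/
abbrev Leg : Type _ := (v : V) × Fin (G.kind v).arity

/-- The `φ̄`-leg joined to a given `φ`-leg by the strand of color `s` inside a vertex. -/
def through (s : Fin 3) (h : G.Leg) : G.Leg := ⟨h.1, (G.kind h.1).strandPerm s h.2⟩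

/-- `v` is an end of the line `l`. -/
def Incident (l : L) (v : V) : Prop := (G.phiEnd l).1 = v ∨ (G.barEnd l).1 = v

/-- Connectedness of the graph (in particular it has a vertex). -/
def Connected : Prop :=
  (SimpleGraph.fromRel fun v w : V => ∃ l, (G.phiEnd l).1 = v ∧ (G.barEnd l).1 = w).Connected

open Classical in
/-- The integrand of the amplitude `A_{G;μ}` at momenta `p` of the `φ`-legs and `q` of the
`φ̄`-legs: propagator slices on the lines, vertex operators, and the Fourier modes of the test
functions on the external legs (`f` at external `φ`-legs, `g` at external `φ̄`-legs; their values
at internal legs are not used). -/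
def integrand [Fintype V] [Fintype L] (M : ℕ) (a : Fin 3 → ℝ) (m : ℝ) (μ : L → ℕ)
    (f g : G.Leg → UnitAddTorus (Fin 3) → ℂ) (pq : (G.Leg → Fin 3 → ℤ) × (G.Leg → Fin 3 → ℤ)) :
    ℂ :=
  (∏ l, (propagator M a m (μ l) (pq.1 (G.phiEnd l)) (pq.2 (G.barEnd l)) : ℂ)) *
  (∏ v, ((G.kind v).kernel (fun j => pq.1 ⟨v, j⟩) (fun j => pq.2 ⟨v, j⟩) : ℂ)) *
  (∏ h with h ∉ Set.range G.phiEnd, UnitAddTorus.mFourierCoeff (f h) (pq.1 h)) *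
  (∏ h with h ∉ Set.range G.barEnd,
    (starRingEnd ℂ) (UnitAddTorus.mFourierCoeff (g h) (pq.2 h)))

/-- The amplitude `A_{G;μ}`: the sum over all momenta. -/
def amplitude [Fintype V] [Fintype L] (M : ℕ) (a : Fin 3 → ℝ) (m : ℝ) (μ : L → ℕ)
    (f g : G.Leg → UnitAddTorus (Fin 3) → ℂ) : ℂ :=
  ∑' pq, G.integrand M a m μ f g pq

open Classical in
/-- The connected component of the line `l` in the subgraph made of the lines in `S`. -/
def component (S : Finset L) (l : L) : Finset L :=
  S.filter fun l' => Relation.ReflTransGen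
    (fun x y => x ∈ S ∧ y ∈ S ∧ ∃ v, G.Incident x v ∧ G.Incident y v) l l'

open Classical in
/-- The high subgraphs `G_i^k`, `k = 1, …, k(i)`: the connected components of the subgraph `G_i`
made of all lines of scale at least `i`. A subgraph is given by its set of lines; its vertices are
the ends of these lines. -/
def highSubgraphs [Fintype L] (μ : L → ℕ) (i : ℕ) : Finset (Finset L) :=
  let S : Finset L := Finset.univ.filter fun l => i ≤ μ l
  S.image (G.component S)

/-- Following the strand of color `s` of the line `l` from its `φ`-end to its `φ̄`-end and then
through the vertex found there, one enters the line `l'`. -/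
def Next (s : Fin 3) (l l' : L) : Prop := G.through s (G.phiEnd l') = G.barEnd l

open Classical in
/-- The internal (closed) faces of `G`. A face of color `s` uses the strand of color `s` of each
line it visits, so it is given by its color and its set of lines; it is closed when following it
one comes back to the line one started from. -/
def internalFaces [Fintype L] : Finset (Fin 3 × Finset L) :=
  (Finset.univ.filter fun sl : Fin 3 × L => Relation.TransGen (G.Next sl.1) sl.2 sl.2).image
    fun sl => (sl.1, Finset.univ.filter fun l' => Relation.ReflTransGen (G.Next sl.1) sl.2 l')

open Classical in
/-- `F_int(g)`: the number of closed faces of the subgraph `g`, that is of closed faces of `G` all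
of whose lines are in `g`. -/
def Fint [Fintype L] (g : Finset L) : ℕ := (G.internalFaces.filter fun F => F.2 ⊆ g).card

open Classical in
/-- `V'_{s;2}(g)`: the number of wave-function vertices of color `s` of the subgraph `g`. -/
def waveCount [Fintype V] (s : Fin 3) (g : Finset L) : ℕ :=
  (Finset.univ.filter fun v : V => G.kind v = .wave s ∧ ∃ l ∈ g, G.Incident l v).card

/-- The divergence degree `ω_d(g) = -L(g) + F_int(g) + ∑_s V'_{s;2}(g)` of a subgraph. -/
def divergenceDegree [Fintype V] [Fintype L] (g : Finset L) : ℤ :=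
  -(g.card : ℤ) + (G.Fint g : ℤ) + ∑ s : Fin 3, (G.waveCount s g : ℤ)

end TensorGraph

end TensorModel

end

/-!
The absolute value of the integrand is summed directly, strand by strand.

Momentum conservation along the strands (`TensorGraph.Conserved`) leaves one free momentum for each
closed face and one for each strand that starts at an external `φ`-leg
(`Conserved.eq_of_agree`). The sum over a family of independent momenta factorizes
(`summable_and_norm_tsum_le_prod`), so it is enough to bound the integrand by a product of summable
functions of these momenta.

* A slice of scale `i` is bounded by `K M⁻ⁱ ∏ₛ exp (-c M⁻ⁱ |pₛ|)` (`exists_slice_bounds`), so each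
  line gives `M⁻ⁱ`.
* In a closed face only the exponential decay of its line of lowest scale `i` is kept; the sum over
  the momentum of the face then costs `Mⁱ` (`tsum_exp_scale_le`).
* The factor `|pₛ|` of a wave-function vertex is attributed to its `φ̄`-leg. Since every line has
  exactly one `φ̄`-end, no line pays twice. A line of scale `i` pays with half of its exponential
  decay, at the cost of `Mⁱ`; an external leg pays with the decay of the test function.
* Strands starting at external `φ`-legs are summed with the decay of the Fourier coefficients of the
  test functions, which is uniform over a family bounded in `C^∞` (`BoundedSmooth.mFourierCoeff_le`)
  by repeated integration by parts.

The powers of `M` obtained are then distributed over the scales (`le_prod_highSubgraphs`): a line of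
scale `i` lies in exactly one high subgraph at each scale `0, …, i`. The same holds for a closed face
whose lowest line has scale `i`, and a wave-function vertex with a line of scale `i` belongs to at
least one high subgraph at each of these scales. All remaining constants are powers of
`Fintype.card V`, because a graph has at most two lines, and boundedly many faces and external legs,
per vertex.
-/

noncomputable section

namespace TensorModel

open MeasureTheory UnitAddTorus

/-! ### Decay of Fourier coefficients, uniformly in a bounded family -/

/-- A family of functions on the torus that is bounded in `C^∞`. -/
structure BoundedSmooth {J : Type*} (f : J → UnitAddTorus (Fin 3) → ℂ) : Prop where
  contDiff : ∀ j, ContDiff ℝ ∞ (lift (f j))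
  bound : ∀ k : ℕ, ∃ B : ℝ, ∀ j x, ‖iteratedFDeriv ℝ k (lift (f j)) x‖ ≤ B

/-- The partial derivative of a function on the torus, as a function on the torus. -/
def torusDeriv (s : Fin 3) (f : UnitAddTorus (Fin 3) → ℂ) (y : UnitAddTorus (Fin 3)) : ℂ :=
  deriv (fun t : ℝ => f (y + Pi.single s (t : UnitAddCircle))) 0

lemma isOpenQuotientMap_torusProj :
    IsOpenQuotientMap (fun (x : Fin 3 → ℝ) (s : Fin 3) => (x s : UnitAddCircle)) :=
  IsOpenQuotientMap.piMap (f := fun (_ : Fin 3) (x : ℝ) => (x : UnitAddCircle))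
    fun _ => QuotientAddGroup.isOpenQuotientMap_mk

lemma continuous_of_lift {f : UnitAddTorus (Fin 3) → ℂ} (h : Continuous (lift f)) :
    Continuous f :=
  isOpenQuotientMap_torusProj.isQuotientMap.continuous_iff.2 h

lemma hasDerivAt_torus_translate {f : UnitAddTorus (Fin 3) → ℂ} (h : ContDiff ℝ ∞ (lift f))
    (s : Fin 3) (x : Fin 3 → ℝ) (t : ℝ) :
    HasDerivAt (fun t : ℝ => f ((fun s => (x s : UnitAddCircle)) +
        Pi.single s (t : UnitAddCircle)))
      (fderiv ℝ (lift f) (x + t • Pi.single s 1) (Pi.single s 1)) t := by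
  have h1 : HasDerivAt (fun t : ℝ => x + t • (Pi.single s 1 : Fin 3 → ℝ)) (Pi.single s 1) t := by
    simpa using ((hasDerivAt_id t).smul_const (Pi.single s 1 : Fin 3 → ℝ)).const_add x
  have h2 := ((h.differentiable (by simp)) (x + t • Pi.single s 1)).hasFDerivAt.comp_hasDerivAt t h1
  refine h2.congr_of_eventuallyEq (Filter.Eventually.of_forall fun u => ?_)
  simp only [Function.comp, lift]
  congr 1
  ext r
  rcases eq_or_ne r s with rfl | hr
  · simp
  · simp [hr]

lemma lift_torusDeriv {f : UnitAddTorus (Fin 3) → ℂ} (h : ContDiff ℝ ∞ (lift f)) (s : Fin 3) :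
    lift (torusDeriv s f) = fun x => fderiv ℝ (lift f) x (Pi.single s 1) := by
  funext x
  simpa [lift, torusDeriv] using (hasDerivAt_torus_translate h s x 0).deriv

lemma BoundedSmooth.torusDeriv {J : Type*} {f : J → UnitAddTorus (Fin 3) → ℂ}
    (hf : BoundedSmooth f) (s : Fin 3) : BoundedSmooth fun j => torusDeriv s (f j) where
  contDiff j := by
    rw [lift_torusDeriv (hf.contDiff j)]
    exact ((hf.contDiff j).fderiv_right (m := ∞) (by simp)).clm_apply contDiff_const
  bound k := by
    obtain ⟨B, hB⟩ := hf.bound (k + 1)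
    refine ⟨‖ContinuousLinearMap.apply ℝ ℂ (Pi.single s 1 : Fin 3 → ℝ)‖ * B, fun j x => ?_⟩
    rw [lift_torusDeriv (hf.contDiff j)]
    have h1 : ContDiff ℝ ∞ (fderiv ℝ (lift (f j))) :=
      (hf.contDiff j).fderiv_right (m := ∞) (by simp)
    have h2 := (ContinuousLinearMap.apply ℝ ℂ (Pi.single s 1 : Fin 3 → ℝ)).norm_iteratedFDeriv_comp_left
      (h1.contDiffAt (x := x)) (n := k) (by exact_mod_cast le_top)
    refine h2.trans ?_
    rw [norm_iteratedFDeriv_fderiv]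
    exact mul_le_mul_of_nonneg_left (hB j x) (norm_nonneg _)

lemma BoundedSmooth.norm_le {J : Type*} {f : J → UnitAddTorus (Fin 3) → ℂ}
    (hf : BoundedSmooth f) : ∃ B : ℝ, ∀ j y, ‖f j y‖ ≤ B := by
  obtain ⟨B, hB⟩ := hf.bound 0
  refine ⟨B, fun j y => ?_⟩
  obtain ⟨x, rfl⟩ := isOpenQuotientMap_torusProj.surjective y
  simpa [lift] using hB j x

lemma BoundedSmooth.continuous {J : Type*} {f : J → UnitAddTorus (Fin 3) → ℂ}
    (hf : BoundedSmooth f) (j : J) : Continuous (f j) :=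
  continuous_of_lift (hf.contDiff j).continuous

/-- The normalized Haar measure of the torus, the one `mFourierCoeff` integrates against. -/
abbrev torusMeasure : Measure (UnitAddTorus (Fin 3)) :=
  Measure.pi fun _ => AddCircle.haarAddCircle

lemma mFourierCoeff_eq_integral (f : UnitAddTorus (Fin 3) → ℂ) (n : Fin 3 → ℤ) :
    mFourierCoeff f n = ∫ y, mFourier (-n) y * f y ∂torusMeasure := rfl

lemma norm_mFourier_apply (n : Fin 3 → ℤ) (y : UnitAddTorus (Fin 3)) : ‖mFourier n y‖ = 1 := by
  simp only [mFourier, fourier_apply, ContinuousMap.coe_mk, norm_prod, Circle.norm_coe,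
    Finset.prod_const_one]

lemma norm_mFourierCoeff_le {f : UnitAddTorus (Fin 3) → ℂ} {B : ℝ} (h : ∀ y, ‖f y‖ ≤ B)
    (n : Fin 3 → ℤ) : ‖mFourierCoeff f n‖ ≤ B := by
  rw [mFourierCoeff_eq_integral]
  refine (norm_integral_le_of_norm_le_const (C := B) (Filter.Eventually.of_forall fun y => ?_)).trans
    (by simp)
  rw [norm_mul, norm_mFourier_apply, one_mul]
  exact h y

lemma mFourier_apply_add (n : Fin 3 → ℤ) (y z : UnitAddTorus (Fin 3)) :
    mFourier n (y + z) = mFourier n y * mFourier n z := by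
  simp [mFourier, fourier_apply, AddCircle.toCircle_add, Finset.prod_mul_distrib]

lemma mFourier_neg_single (n : Fin 3 → ℤ) (s : Fin 3) (t : ℝ) :
    mFourier (-n) (-Pi.single s (t : UnitAddCircle)) =
      Complex.exp (2 * Real.pi * Complex.I * n s * t) := by
  have : ∀ r, fourier ((-n) r) ((-Pi.single s (t : UnitAddCircle) : UnitAddTorus (Fin 3)) r) =
      if r = s then Complex.exp (2 * Real.pi * Complex.I * n s * t) else 1 := by
    intro r
    rcases eq_or_ne r s with rfl | hr
    · rw [if_pos rfl, Pi.neg_apply, Pi.neg_apply, Pi.single_eq_same, ← AddCircle.coe_neg,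
        fourier_coe_apply]
      congr 1
      push_cast
      ring
    · simp [hr]
  simp only [mFourier, ContinuousMap.coe_mk]
  rw [Finset.prod_congr rfl fun r _ => this r]
  simp

lemma hasDerivAt_torus_translate_torusDeriv {f : UnitAddTorus (Fin 3) → ℂ}
    (h : ContDiff ℝ ∞ (lift f)) (s : Fin 3) (y : UnitAddTorus (Fin 3)) (t : ℝ) :
    HasDerivAt (fun t : ℝ => f (y + Pi.single s (t : UnitAddCircle)))
      (torusDeriv s f (y + Pi.single s (t : UnitAddCircle))) t := by
  obtain ⟨x, rfl⟩ := isOpenQuotientMap_torusProj.surjective y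
  have h1 := hasDerivAt_torus_translate h s x t
  have h2 := congrFun (lift_torusDeriv h s) (x + t • Pi.single s 1)
  rw [← h2] at h1
  have h3 : (fun r => ((x + t • (Pi.single s 1 : Fin 3 → ℝ)) r : UnitAddCircle)) =
      (fun r => (x r : UnitAddCircle)) + Pi.single s (t : UnitAddCircle) := by
    ext r
    rcases eq_or_ne r s with rfl | hr
    · simp
    · simp [hr]
  rwa [lift, h3] at h1

lemma integral_mFourier_mul_translate (f : UnitAddTorus (Fin 3) → ℂ) (n : Fin 3 → ℤ)
    (s : Fin 3) (t : ℝ) :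
    ∫ y, mFourier (-n) y * f (y + Pi.single s (t : UnitAddCircle)) ∂torusMeasure =
      Complex.exp (2 * Real.pi * Complex.I * n s * t) * mFourierCoeff f n := by
  rw [mFourierCoeff_eq_integral, ← integral_const_mul,
    ← integral_add_right_eq_self _ (-Pi.single s (t : UnitAddCircle) : UnitAddTorus (Fin 3))]
  refine integral_congr_ae (Filter.Eventually.of_forall fun y => ?_)
  simp only [mFourier_apply_add, mFourier_neg_single, neg_add_cancel_right]
  ring

lemma hasDerivAt_integral_mFourier_translate {J : Type*} {f : J → UnitAddTorus (Fin 3) → ℂ}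
    (hf : BoundedSmooth f) (s : Fin 3) (j : J) (n : Fin 3 → ℤ) :
    HasDerivAt
      (fun t : ℝ => ∫ y, mFourier (-n) y * f j (y + Pi.single s (t : UnitAddCircle)) ∂torusMeasure)
      (∫ y, mFourier (-n) y * TensorModel.torusDeriv s (f j)
        (y + Pi.single s ((0 : ℝ) : UnitAddCircle)) ∂torusMeasure) 0 := by
  obtain ⟨B, hB⟩ := (hf.torusDeriv s).norm_le
  have hcont : ∀ (g : UnitAddTorus (Fin 3) → ℂ) (t : ℝ), Continuous g → Continuous fun y =>
      mFourier (-n) y * g (y + Pi.single s (t : UnitAddCircle)) := fun g t hg =>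
    (mFourier (-n)).continuous.mul (hg.comp (continuous_id.add continuous_const))
  refine (hasDerivAt_integral_of_dominated_loc_of_deriv_le (μ := torusMeasure)
    (F := fun (t : ℝ) y => mFourier (-n) y * f j (y + Pi.single s (t : UnitAddCircle)))
    (F' := fun (t : ℝ) y =>
      mFourier (-n) y * TensorModel.torusDeriv s (f j) (y + Pi.single s (t : UnitAddCircle)))
    (x₀ := 0) (s := Set.univ) (bound := fun _ => B) Filter.univ_mem
    (Filter.Eventually.of_forall fun t => ?_) ?_ ?_
    (Filter.Eventually.of_forall fun y t _ => ?_) (integrable_const _)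
    (Filter.Eventually.of_forall fun y t _ => ?_)).2
  · exact (hcont _ t (hf.continuous j)).aestronglyMeasurable
  · exact (hcont _ 0 (hf.continuous j)).integrable_of_hasCompactSupport
      (HasCompactSupport.of_compactSpace _)
  · exact (hcont _ 0 ((hf.torusDeriv s).continuous j)).aestronglyMeasurable
  · rw [norm_mul, norm_mFourier_apply, one_mul]
    exact hB j _
  · exact (hasDerivAt_torus_translate_torusDeriv (hf.contDiff j) s y t).const_mul _

/-- Integration by parts, obtained by differentiating the translates of `f` under the integral. -/
lemma mFourierCoeff_torusDeriv {J : Type*} {f : J → UnitAddTorus (Fin 3) → ℂ}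
    (hf : BoundedSmooth f) (s : Fin 3) (j : J) (n : Fin 3 → ℤ) :
    mFourierCoeff (torusDeriv s (f j)) n =
      2 * Real.pi * Complex.I * n s * mFourierCoeff (f j) n := by
  have key := hasDerivAt_integral_mFourier_translate hf s j n
  rw [integral_mFourier_mul_translate] at key
  simp only [integral_mFourier_mul_translate] at key
  have hexp : HasDerivAt (fun t : ℝ => Complex.exp (2 * Real.pi * Complex.I * n s * t) *
      mFourierCoeff (f j) n) (2 * Real.pi * Complex.I * n s * mFourierCoeff (f j) n) 0 := by
    have h1 : HasDerivAt (fun t : ℝ => 2 * Real.pi * Complex.I * n s * (t : ℂ))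
        (2 * Real.pi * Complex.I * n s) 0 := by
      simpa using (Complex.ofRealCLM.hasDerivAt (x := (0 : ℝ))).const_mul
        (2 * Real.pi * Complex.I * n s : ℂ)
    simpa using h1.cexp.mul_const (mFourierCoeff (f j) n)
  simpa using key.unique hexp

lemma BoundedSmooth.mFourierCoeff_decay {J : Type*} (colors : List (Fin 3)) :
    ∀ {f : J → UnitAddTorus (Fin 3) → ℂ}, BoundedSmooth f →
      ∃ B : ℝ, ∀ j n, ‖mFourierCoeff (f j) n‖ *
        (colors.map fun s => 1 + |(n s : ℝ)|).prod ≤ B := by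
  induction colors with
  | nil =>
    intro f hf
    obtain ⟨B, hB⟩ := hf.norm_le
    exact ⟨B, fun j n => by simpa using norm_mFourierCoeff_le (hB j) n⟩
  | cons s colors ih =>
    intro f hf
    obtain ⟨B, hB⟩ := ih hf
    obtain ⟨B', hB'⟩ := ih (hf.torusDeriv s)
    refine ⟨B + B', fun j n => ?_⟩
    have h0 : (0 : ℝ) ≤ (colors.map fun s => 1 + |(n s : ℝ)|).prod :=
      List.prod_nonneg (by simp only [List.mem_map]; rintro _ ⟨s, -, rfl⟩; positivity)
    have h1 := hB j n
    have h2 := hB' j n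
    rw [mFourierCoeff_torusDeriv hf s j n] at h2
    have h3 : |(n s : ℝ)| * ‖mFourierCoeff (f j) n‖ ≤
        ‖2 * Real.pi * Complex.I * n s * mFourierCoeff (f j) n‖ := by
      simp only [norm_mul, Complex.norm_I, Complex.norm_intCast, Complex.norm_real, mul_one,
        Complex.norm_ofNat, Real.norm_eq_abs, abs_of_pos Real.pi_pos]
      have : (1 : ℝ) ≤ 2 * Real.pi := by linarith [Real.two_le_pi]
      have h : 0 ≤ |(n s : ℝ)| * ‖mFourierCoeff (f j) n‖ := by positivity
      nlinarith
    have h4 := mul_le_mul_of_nonneg_right h3 h0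
    simp only [List.map_cons, List.prod_cons]
    nlinarith

/-- The Fourier coefficients of a family bounded in `C^∞` decay quadratically in each momentum,
uniformly over the family. -/
lemma BoundedSmooth.mFourierCoeff_le {J : Type*} {f : J → UnitAddTorus (Fin 3) → ℂ}
    (hf : BoundedSmooth f) :
    ∃ B : ℝ, 1 ≤ B ∧ ∀ j n, ‖mFourierCoeff (f j) n‖ ≤ B * ∏ s, ((1 + |(n s : ℝ)|) ^ 2)⁻¹ := by
  obtain ⟨B, hB⟩ := hf.mFourierCoeff_decay [0, 0, 1, 1, 2, 2]
  refine ⟨max B 1, le_max_right _ _, fun j n => ?_⟩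
  rw [Finset.prod_inv_distrib, ← div_eq_mul_inv, le_div_iff₀ (by positivity)]
  refine le_trans (le_of_eq ?_) ((hB j n).trans (le_max_left _ _))
  simp only [Fin.prod_univ_three, List.map_cons, List.map_nil, List.prod_cons, List.prod_nil]
  ring


/-! ### Bounds on the slices and sums over one momentum -/

lemma slice_bound {M : ℕ} (hM : 2 ≤ M) {a : Fin 3 → ℝ} (ha : ∀ s, 0 < a s) {m : ℝ}
    (hm : 0 < m) (i : ℕ) (p : Fin 3 → ℤ) :
    0 ≤ slice M a m i p ∧ slice M a m i p ≤
      (m⁻¹ + M) * (M : ℝ)⁻¹ ^ i * Real.exp (-(M : ℝ)⁻¹ ^ i * ∑ s, a s * |(p s : ℝ)|) := by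
  have hM0 : (0 : ℝ) < M := by positivity
  have hM1 : (1 : ℝ) ≤ M := by exact_mod_cast (by omega : 1 ≤ M)
  set X := ∑ s, a s * |(p s : ℝ)| with hX
  have hX0 : 0 ≤ X := Finset.sum_nonneg fun s _ => mul_nonneg (ha s).le (abs_nonneg _)
  cases i with
  | zero =>
    have h : slice M a m 0 p = Real.exp (-(X + m)) / (X + m) := by
      have := integral_exp_mul_Ioi (a := -(X + m)) (by linarith) 1
      simp only [slice]
      rw [mul_one, neg_div_neg_eq] at this
      rw [← this]
      congr 1
      ext α
      congr 1
      ring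
    rw [h]
    refine ⟨by positivity, ?_⟩
    rw [pow_zero, mul_one, neg_mul, one_mul, div_eq_mul_inv, mul_comm]
    refine mul_le_mul ?_ (Real.exp_le_exp.2 (by linarith)) (by positivity) (by positivity)
    have : (X + m)⁻¹ ≤ m⁻¹ := inv_anti₀ hm (by linarith)
    linarith
  | succ i =>
    have hle : (M : ℝ)⁻¹ ^ (i + 1) ≤ (M : ℝ)⁻¹ ^ i :=
      pow_le_pow_of_le_one (by positivity) (inv_le_one_of_one_le₀ hM1) (Nat.le_succ i)
    simp only [slice]
    refine ⟨intervalIntegral.integral_nonneg hle fun _ _ => by positivity, ?_⟩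
    have h1 : ∀ α ∈ Set.uIoc ((M : ℝ)⁻¹ ^ (i + 1)) ((M : ℝ)⁻¹ ^ i),
        ‖Real.exp (-α * (∑ s, a s * |(p s : ℝ)| + m))‖ ≤
          Real.exp (-(M : ℝ)⁻¹ ^ (i + 1) * X) := by
      intro α hα
      rw [Set.uIoc_of_le hle] at hα
      rw [Real.norm_eq_abs, abs_of_pos (Real.exp_pos _), Real.exp_le_exp, ← hX]
      have h0 : (0 : ℝ) < (M : ℝ)⁻¹ ^ (i + 1) := by positivity
      nlinarith [mul_le_mul_of_nonneg_right hα.1.le hX0, mul_pos (h0.trans hα.1) hm]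
    refine (Real.le_norm_self _).trans
      ((intervalIntegral.norm_integral_le_of_norm_le_const h1).trans ?_)
    rw [mul_comm]
    refine mul_le_mul_of_nonneg_right ?_ (by positivity)
    rw [abs_of_nonneg (by linarith)]
    have h2 : (M : ℝ)⁻¹ ^ i = M * (M : ℝ)⁻¹ ^ (i + 1) := by
      rw [pow_succ]
      field_simp
    have h3 : (0 : ℝ) < (M : ℝ)⁻¹ ^ (i + 1) := by positivity
    have h4 : 0 < m⁻¹ * (M : ℝ)⁻¹ ^ (i + 1) := by positivity
    nlinarith

/-- A slice of scale `i` has size `M⁻ⁱ` and cuts off the momenta at `Mⁱ`. Multiplying it by one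
momentum costs a factor `Mⁱ`, paid for by half of the exponential decay. -/
lemma exists_slice_bounds {M : ℕ} (hM : 2 ≤ M) {a : Fin 3 → ℝ} (ha : ∀ s, 0 < a s) {m : ℝ}
    (hm : 0 < m) : ∃ K c : ℝ, 1 ≤ K ∧ 0 < c ∧ ∀ i p,
      0 ≤ slice M a m i p ∧
      slice M a m i p ≤
        K * (M : ℝ)⁻¹ ^ i * ∏ s, Real.exp (-(c * (M : ℝ)⁻¹ ^ i) * |(p s : ℝ)|) ∧
      ∀ r, slice M a m i p * |(p r : ℝ)| ≤
        K * ∏ s, Real.exp (-(c * (M : ℝ)⁻¹ ^ i) * |(p s : ℝ)|) := by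
  have hM0 : (0 : ℝ) < M := by positivity
  have hM1 : (1 : ℝ) ≤ M := by exact_mod_cast (by omega : 1 ≤ M)
  obtain ⟨δ, hδ, hδa⟩ : ∃ δ : ℝ, 0 < δ ∧ ∀ s, δ ≤ a s := by
    obtain ⟨s₀, hs₀⟩ := Finite.exists_min a
    exact ⟨a s₀, ha s₀, hs₀⟩
  set A : ℝ := m⁻¹ + M with hA
  have hA1 : 1 ≤ A := by
    have : 0 < m⁻¹ := by positivity
    linarith
  refine ⟨max A (A * (2 / δ)), δ / 2, hA1.trans (le_max_left _ _), by positivity, fun i p => ?_⟩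
  obtain ⟨h0, h1⟩ := slice_bound hM ha hm i p
  set t : ℝ := (M : ℝ)⁻¹ ^ i with ht
  have ht0 : 0 < t := by positivity
  rw [← Real.exp_sum, ← Finset.mul_sum]
  set Y := ∑ s, |(p s : ℝ)| with hY
  have hY0 : 0 ≤ Y := Finset.sum_nonneg fun _ _ => abs_nonneg _
  have hXY : δ * Y ≤ ∑ s, a s * |(p s : ℝ)| := by
    rw [hY, Finset.mul_sum]
    exact Finset.sum_le_sum fun s _ => mul_le_mul_of_nonneg_right (hδa s) (abs_nonneg _)
  have h2 : Real.exp (-t * ∑ s, a s * |(p s : ℝ)|) ≤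
      Real.exp (-(δ / 2 * t) * Y) * Real.exp (-(δ / 2 * t * Y)) := by
    rw [← Real.exp_add, Real.exp_le_exp]
    nlinarith
  have h3 : slice M a m i p ≤ A * t * (Real.exp (-(δ / 2 * t) * Y) *
      Real.exp (-(δ / 2 * t * Y))) :=
    h1.trans (mul_le_mul_of_nonneg_left h2 (by positivity))
  have h4 : Real.exp (-(δ / 2 * t * Y)) ≤ 1 := Real.exp_le_one_iff.2 (by
    have : 0 ≤ δ / 2 * t * Y := by positivity
    linarith)
  refine ⟨h0, ?_, fun r => ?_⟩
  · calc slice M a m i p ≤ A * t * (Real.exp (-(δ / 2 * t) * Y) *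
          Real.exp (-(δ / 2 * t * Y))) := h3
      _ ≤ A * t * (Real.exp (-(δ / 2 * t) * Y) * 1) := by gcongr
      _ ≤ _ := by
        rw [mul_one]
        gcongr
        exact le_max_left _ _
  · have hr : |(p r : ℝ)| ≤ Y :=
      Finset.single_le_sum (f := fun s => |(p s : ℝ)|) (fun _ _ => abs_nonneg _)
        (Finset.mem_univ r)
    have h5 : Real.exp (-(δ / 2 * t * Y)) * (δ / 2 * t * Y) ≤ 1 := by
      rw [Real.exp_neg, inv_mul_le_iff₀ (Real.exp_pos _), mul_one]
      linarith [Real.add_one_le_exp (δ / 2 * t * Y)]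
    calc slice M a m i p * |(p r : ℝ)|
        ≤ A * t * (Real.exp (-(δ / 2 * t) * Y) * Real.exp (-(δ / 2 * t * Y))) * Y := by
          gcongr
      _ = A * (2 / δ) * Real.exp (-(δ / 2 * t) * Y) *
          (Real.exp (-(δ / 2 * t * Y)) * (δ / 2 * t * Y)) := by
          field_simp
      _ ≤ A * (2 / δ) * Real.exp (-(δ / 2 * t) * Y) * 1 := by gcongr
      _ ≤ _ := by
        rw [mul_one]
        gcongr
        exact le_max_right _ _

lemma summable_exp_neg_mul_abs {t : ℝ} (ht : 0 < t) :
    Summable (fun n : ℤ => Real.exp (-t * |(n : ℝ)|)) ∧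
      ∑' n : ℤ, Real.exp (-t * |(n : ℝ)|) ≤ 2 + 2 / t := by
  have hr : Real.exp (-t) < 1 := by simpa using ht
  have hr0 : 0 ≤ Real.exp (-t) := (Real.exp_pos _).le
  have e1 : ∀ n : ℕ, Real.exp (-t * |((n : ℤ) : ℝ)|) = Real.exp (-t) ^ n := by
    intro n
    rw [← Real.exp_nat_mul, Int.cast_natCast, abs_of_nonneg (by positivity : (0 : ℝ) ≤ n)]
    ring_nf
  have e2 : ∀ n : ℕ, Real.exp (-t * |((-((n : ℤ) + 1) : ℤ) : ℝ)|) =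
      Real.exp (-t) ^ n * Real.exp (-t) := by
    intro n
    rw [← e1 (n), ← Real.exp_add]
    push_cast
    rw [abs_neg, abs_of_nonneg (by positivity : (0 : ℝ) ≤ n),
      abs_of_nonneg (by positivity : (0 : ℝ) ≤ (n : ℝ) + 1)]
    ring_nf
  have g := hasSum_geometric_of_lt_one hr0 hr
  have h := HasSum.of_nat_of_neg_add_one (f := fun n : ℤ => Real.exp (-t * |(n : ℝ)|))
    (by simpa only [e1] using g) (by simpa only [e2] using g.mul_right (Real.exp (-t)))
  refine ⟨h.summable, ?_⟩
  rw [h.tsum_eq]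
  have h1 : t / (1 + t) ≤ 1 - Real.exp (-t) := by
    have h2 : Real.exp (-t) ≤ (1 + t)⁻¹ := by
      rw [Real.exp_neg]
      exact inv_anti₀ (by positivity) (by linarith [Real.add_one_le_exp t])
    have h3 : t / (1 + t) = 1 - (1 + t)⁻¹ := by field_simp; ring
    linarith
  have h4 : (1 - Real.exp (-t))⁻¹ ≤ 1 + 1 / t := by
    refine (inv_anti₀ (by positivity) h1).trans (le_of_eq ?_)
    field_simp
    ring
  have h5 : (1 - Real.exp (-t))⁻¹ * Real.exp (-t) ≤ (1 - Real.exp (-t))⁻¹ :=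
    mul_le_of_le_one_right (inv_nonneg.2 (by linarith)) hr.le
  calc _ ≤ 2 * (1 + 1 / t) := by linarith
    _ = 2 + 2 / t := by ring

/-- The sum over the momentum of a closed face whose lowest line has scale `i` costs `Mⁱ`. -/
lemma tsum_exp_scale_le {M : ℕ} (hM : 2 ≤ M) {c : ℝ} (hc : 0 < c) (i : ℕ) :
    ∑' n : ℤ, Real.exp (-(c * (M : ℝ)⁻¹ ^ i) * |(n : ℝ)|) ≤ (2 + 2 / c) * (M : ℝ) ^ i := by
  have hM1 : (1 : ℝ) ≤ M := by exact_mod_cast (by omega : 1 ≤ M)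
  refine (summable_exp_neg_mul_abs (by positivity)).2.trans ?_
  have h1 : (1 : ℝ) ≤ (M : ℝ) ^ i := one_le_pow₀ hM1
  have h2 : 2 / (c * (M : ℝ)⁻¹ ^ i) = 2 / c * (M : ℝ) ^ i := by
    rw [inv_pow]
    field_simp
  rw [h2]
  nlinarith

lemma summable_inv_one_add_abs_sq : Summable fun n : ℤ => ((1 + |(n : ℝ)|) ^ 2)⁻¹ := by
  have h : Summable fun n : ℕ => ((1 + (n : ℝ)) ^ 2)⁻¹ := by
    have := (summable_nat_add_iff 1).2 (Real.summable_nat_pow_inv.2 (by norm_num : 1 < 2))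
    simpa [add_comm] using this
  refine Summable.of_nat_of_neg ?_ ?_ <;> simpa using h

/-- A sum supported on the set `S` is bounded by a product of one-variable sums, if the points of
`S` are determined by coordinates `Φ` in which the terms are bounded by a product. -/
lemma summable_and_norm_tsum_le_prod {ι R E : Type*} [Fintype R] [NormedAddCommGroup E]
    [CompleteSpace E] {F : ι → E} {S : Set ι} {Φ : ι → R → ℤ} (hinj : S.InjOn Φ)
    {w : R → ℤ → ℝ} (hw0 : ∀ r n, 0 ≤ w r n) (hw : ∀ r, Summable (w r)) {C : ℝ} (hC : 0 ≤ C)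
    (hsupp : ∀ x, x ∉ S → F x = 0) (hF : ∀ x ∈ S, ‖F x‖ ≤ C * ∏ r, w r (Φ x r)) :
    Summable F ∧ ‖∑' x, F x‖ ≤ C * ∏ r, ∑' n, w r n := by
  classical
  have hfin : ∀ u : Finset ι, ∑ x ∈ u, ‖F x‖ ≤ C * ∏ r, ∑' n, w r n := by
    intro u
    have h1 : ∑ x ∈ u, ‖F x‖ = ∑ x ∈ u with x ∈ S, ‖F x‖ := by
      refine (Finset.sum_filter_of_ne fun x _ hx => ?_).symm
      by_contra h
      exact hx (by rw [hsupp x h, norm_zero])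
    have hinj' : Set.InjOn Φ ((u.filter (· ∈ S) : Finset ι) : Set ι) :=
      hinj.mono fun x hx => (Finset.mem_filter.1 hx).2
    calc ∑ x ∈ u, ‖F x‖ = ∑ x ∈ u with x ∈ S, ‖F x‖ := h1
      _ ≤ ∑ x ∈ u with x ∈ S, C * ∏ r, w r (Φ x r) :=
        Finset.sum_le_sum fun x hx => hF x (Finset.mem_filter.1 hx).2
      _ = C * ∑ y ∈ (u.filter (· ∈ S)).image Φ, ∏ r, w r (y r) := by
        rw [← Finset.mul_sum, Finset.sum_image hinj']
      _ ≤ C * ∑ y ∈ Fintype.piFinset fun r =>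
            ((u.filter (· ∈ S)).image Φ).image fun y => y r, ∏ r, w r (y r) := by
        refine mul_le_mul_of_nonneg_left (Finset.sum_le_sum_of_subset_of_nonneg ?_
          fun y _ _ => Finset.prod_nonneg fun r _ => hw0 r _) hC
        intro y hy
        exact Fintype.mem_piFinset.2 fun r => Finset.mem_image_of_mem _ hy
      _ = C * ∏ r, ∑ n ∈ ((u.filter (· ∈ S)).image Φ).image fun y => y r, w r n := by
        rw [Finset.prod_univ_sum]
      _ ≤ C * ∏ r, ∑' n, w r n := by
        refine mul_le_mul_of_nonneg_left (Finset.prod_le_prod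
          (fun r _ => Finset.sum_nonneg fun n _ => hw0 r n)
          fun r _ => (hw r).sum_le_tsum _ fun n _ => hw0 r n) hC
  have hs : Summable fun x => ‖F x‖ := summable_of_sum_le (fun x => norm_nonneg _) hfin
  exact ⟨hs.of_norm, (norm_tsum_le_tsum_norm hs).trans (hs.tsum_le_of_sum_le hfin)⟩


/-! ### Closed faces -/

namespace TensorGraph

variable {V L : Type*} (G : TensorGraph V L)

lemma through_bijective (s : Fin 3) : Function.Bijective (G.through s) := by
  constructor
  · rintro ⟨v, j⟩ ⟨v', j'⟩ h
    obtain rfl : v = v' := congrArg Sigma.fst h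
    simpa [through] using h
  · rintro ⟨v, j⟩
    exact ⟨⟨v, ((G.kind v).strandPerm s).symm j⟩, by simp [through]⟩

variable {G}

lemma Next.right_unique {s : Fin 3} {l l₁ l₂ : L} (h₁ : G.Next s l l₁) (h₂ : G.Next s l l₂) :
    l₁ = l₂ :=
  G.phiEnd_injective ((G.through_bijective s).1 (h₁.trans h₂.symm))

lemma Next.left_unique {s : Fin 3} {l l₁ l₂ : L} (h₁ : G.Next s l₁ l) (h₂ : G.Next s l₂ l) :
    l₁ = l₂ :=
  G.barEnd_injective (h₁.symm.trans h₂)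

lemma Next.exists_incident {s : Fin 3} {l l' : L} (h : G.Next s l l') :
    ∃ v, G.Incident l v ∧ G.Incident l' v := by
  have h' : (G.through s (G.phiEnd l')).1 = (G.barEnd l).1 := congrArg (fun x : G.Leg => x.1) h
  exact ⟨(G.barEnd l).1, Or.inr rfl, Or.inl h'⟩

/-- On a closed face one can also go back from `l'` to `l`, by going around. -/
lemma reflTransGen_next_symm {s : Fin 3} {l l' : L} (hl : Relation.TransGen (G.Next s) l l)
    (h : Relation.ReflTransGen (G.Next s) l l') : Relation.ReflTransGen (G.Next s) l' l := by
  induction h with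
  | refl => exact .refl
  | @tail b c _ hbc ih =>
    have h1 : Relation.TransGen (G.Next s) b l := by
      rcases Relation.reflTransGen_iff_eq_or_transGen.1 ih with h | h
      · subst h
        exact hl
      · exact h
    obtain ⟨d, hbd, hd⟩ := Relation.TransGen.head'_iff.1 h1
    rwa [hbc.right_unique hbd]

variable [Fintype L]

lemma mem_internalFaces {F : Fin 3 × Finset L} : F ∈ G.internalFaces ↔
    ∃ l, Relation.TransGen (G.Next F.1) l l ∧
      ∀ l', l' ∈ F.2 ↔ Relation.ReflTransGen (G.Next F.1) l l' := by
  classical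
  obtain ⟨s, A⟩ := F
  simp only [internalFaces, Finset.mem_image, Finset.mem_filter, Finset.mem_univ, true_and,
    Prod.exists, Prod.mk.injEq]
  constructor
  · rintro ⟨_, l, hl, rfl, rfl⟩
    exact ⟨l, hl, fun l' => by simp⟩
  · rintro ⟨l, hl, h⟩
    exact ⟨s, l, hl, rfl, by ext l'; simp [h]⟩

lemma mem_face_iff {F : Fin 3 × Finset L} (hF : F ∈ G.internalFaces) {l l' : L} (hl : l ∈ F.2) :
    l' ∈ F.2 ↔ Relation.ReflTransGen (G.Next F.1) l l' := by
  obtain ⟨l₀, h₀, h⟩ := mem_internalFaces.1 hF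
  rw [h] at hl ⊢
  exact ⟨fun h' => (reflTransGen_next_symm h₀ hl).trans h', fun h' => hl.trans h'⟩

lemma face_ext {F F' : Fin 3 × Finset L} (hF : F ∈ G.internalFaces) (hF' : F' ∈ G.internalFaces)
    (hs : F.1 = F'.1) {l : L} (hl : l ∈ F.2) (hl' : l ∈ F'.2) : F = F' := by
  refine Prod.ext hs (Finset.ext fun l' => ?_)
  rw [mem_face_iff hF hl, mem_face_iff hF' hl', hs]

/-- Every closed face has a line of lowest scale; it is the one that controls the sum over the
momentum of the face. -/
lemma exists_lowest_line (G : TensorGraph V L) (μ : L → ℕ) :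
    ∃ ρ : G.internalFaces → L, ∀ F, ρ F ∈ F.1.2 ∧ ∀ l ∈ F.1.2, μ (ρ F) ≤ μ l := by
  have h : ∀ F : G.internalFaces, ∃ l ∈ F.1.2, ∀ l' ∈ F.1.2, μ l ≤ μ l' := by
    intro F
    obtain ⟨l, -, hl⟩ := mem_internalFaces.1 F.2
    exact Finset.exists_min_image _ μ ⟨l, (hl l).2 .refl⟩
  choose ρ h1 h2 using h
  exact ⟨ρ, fun F => ⟨h1 F, h2 F⟩⟩

lemma lowest_line_injective {μ : L → ℕ} {ρ : G.internalFaces → L}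
    (hρ : ∀ F, ρ F ∈ F.1.2 ∧ ∀ l ∈ F.1.2, μ (ρ F) ≤ μ l) :
    Function.Injective fun F : G.internalFaces => (ρ F, F.1.1) := by
  intro F F' h
  obtain ⟨h1, h2⟩ := Prod.mk.inj h
  exact Subtype.ext (face_ext F.2 F'.2 h2 (hρ F).1 (h1 ▸ (hρ F').1))

/-! ### High subgraphs and the divergence degree -/

/-- The line `l` ends, by its `φ̄`-end, on a wave-function vertex. -/
def EndsOnWave (G : TensorGraph V L) (l : L) : Prop := ∃ s, G.kind (G.barEnd l).1 = .wave s

omit [Fintype L] in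
lemma mem_component {S : Finset L} {l l' : L} : l' ∈ G.component S l ↔ l' ∈ S ∧
    Relation.ReflTransGen (fun x y => x ∈ S ∧ y ∈ S ∧ ∃ v, G.Incident x v ∧ G.Incident y v) l l' := by
  classical
  simp [component]

omit [Fintype L] in
lemma component_eq_of_mem {S : Finset L} {l l' : L} (h : l' ∈ G.component S l) :
    G.component S l' = G.component S l := by
  have h1 := (mem_component.1 h).2
  have : Std.Symm fun x y => x ∈ S ∧ y ∈ S ∧ ∃ v, G.Incident x v ∧ G.Incident y v :=
    ⟨fun x y hxy => ⟨hxy.2.1, hxy.1, hxy.2.2.imp fun v hv => hv.symm⟩⟩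
  have h2 := Relation.ReflTransGen.stdSymm.symm _ _ h1
  ext l''
  rw [mem_component, mem_component]
  exact and_congr_right fun _ => ⟨h1.trans, h2.trans⟩

lemma mem_highSubgraphs {μ : L → ℕ} {i : ℕ} {g : Finset L} : g ∈ G.highSubgraphs μ i ↔
    ∃ l, i ≤ μ l ∧ G.component (Finset.univ.filter fun l => i ≤ μ l) l = g := by
  classical
  simp only [highSubgraphs, Finset.mem_image, Finset.mem_filter, Finset.mem_univ, true_and]

lemma exists_highSubgraph {μ : L → ℕ} {i : ℕ} {l : L} (hl : i ≤ μ l) :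
    ∃ g ∈ G.highSubgraphs μ i, l ∈ g :=
  ⟨_, mem_highSubgraphs.2 ⟨l, hl, rfl⟩, mem_component.2 ⟨by simpa using hl, .refl⟩⟩

/-- The high subgraphs of a given scale are disjoint. -/
lemma sum_card_highSubgraphs_le (μ : L → ℕ) (i : ℕ) :
    ∑ g ∈ G.highSubgraphs μ i, g.card ≤ (Finset.univ.filter fun l => i ≤ μ l).card := by
  classical
  rw [← Finset.card_sigma]
  refine Finset.card_le_card_of_injOn Sigma.snd ?_ ?_
  · rintro ⟨g, l⟩ h
    simp only [Finset.coe_sigma, Set.mem_sigma_iff, Finset.mem_coe] at h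
    obtain ⟨l₀, -, rfl⟩ := mem_highSubgraphs.1 h.1
    exact (mem_component.1 h.2).1
  · rintro ⟨g, l⟩ h ⟨g', l'⟩ h' (rfl : l = l')
    simp only [Finset.coe_sigma, Set.mem_sigma_iff, Finset.mem_coe] at h h'
    obtain ⟨l₀, -, rfl⟩ := mem_highSubgraphs.1 h.1
    obtain ⟨l₁, -, rfl⟩ := mem_highSubgraphs.1 h'.1
    have : G.component (Finset.univ.filter fun l => i ≤ μ l) l₀ =
        G.component (Finset.univ.filter fun l => i ≤ μ l) l₁ :=
      (component_eq_of_mem h.2).symm.trans (component_eq_of_mem h'.2)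
    rw [this]

/-- A closed face all of whose lines have scale at least `i` lies in one high subgraph. -/
lemma card_high_faces_le {μ : L → ℕ} {ρ : G.internalFaces → L}
    (hρ : ∀ F, ρ F ∈ F.1.2 ∧ ∀ l ∈ F.1.2, μ (ρ F) ≤ μ l) (i : ℕ) :
    (Finset.univ.filter fun F => i ≤ μ (ρ F)).card ≤ ∑ g ∈ G.highSubgraphs μ i, G.Fint g := by
  classical
  have h : (Finset.univ.filter fun F => i ≤ μ (ρ F)).image Subtype.val ⊆
      (G.highSubgraphs μ i).biUnion fun g => G.internalFaces.filter fun F => F.2 ⊆ g := by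
    intro F hF
    obtain ⟨F, hF', rfl⟩ := Finset.mem_image.1 hF
    have hi : i ≤ μ (ρ F) := (Finset.mem_filter.1 hF').2
    refine Finset.mem_biUnion.2 ⟨_, mem_highSubgraphs.2 ⟨ρ F, hi, rfl⟩,
      Finset.mem_filter.2 ⟨F.2, fun l hl => ?_⟩⟩
    have hS : ∀ l ∈ F.1.2, l ∈ Finset.univ.filter fun l => i ≤ μ l := fun l hl => by
      simpa using hi.trans ((hρ F).2 l hl)
    refine mem_component.2 ⟨hS l hl, ?_⟩
    have hl' := (mem_face_iff F.2 (hρ F).1).1 hl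
    induction hl' with
    | refl => exact .refl
    | tail hb hbc ih =>
      have hb' := (mem_face_iff F.2 (hρ F).1).2 hb
      exact (ih hb').tail ⟨hS _ hb', hS _ hl, hbc.exists_incident⟩
  rw [← Finset.card_image_of_injective _ Subtype.val_injective]
  refine (Finset.card_le_card h).trans (Finset.card_biUnion_le.trans (le_of_eq ?_))
  exact Finset.sum_congr rfl fun g _ => by rw [Fint]

open Classical in
lemma card_high_waves_le [Fintype V] (μ : L → ℕ) (i : ℕ) :
    (Finset.univ.filter fun l => G.EndsOnWave l ∧ i ≤ μ l).card ≤
      ∑ g ∈ G.highSubgraphs μ i, ∑ s, G.waveCount s g := by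
  have hinj : Set.InjOn (fun l => (G.barEnd l).1)
      ((Finset.univ.filter fun l => G.EndsOnWave l ∧ i ≤ μ l : Finset L) : Set L) := by
    intro l hl l' _ h
    obtain ⟨s, hs⟩ : G.EndsOnWave l := (Finset.mem_filter.1 hl).2.1
    refine G.barEnd_injective ?_
    have hsub : ∀ (v : V) (_ : G.kind v = .wave s) (x y : Fin (G.kind v).arity), x = y := by
      intro v hv
      rw [hv]
      exact fun x y => Subsingleton.elim (α := Fin 1) x y
    have h' : (G.barEnd l).1 = (G.barEnd l').1 := h
    generalize G.barEnd l = x at hs h' ⊢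
    generalize G.barEnd l' = y at h' ⊢
    obtain ⟨v, x⟩ := x
    obtain ⟨w, y⟩ := y
    obtain rfl : v = w := h'
    rw [hsub v hs x y]
  have h : (Finset.univ.filter fun l => G.EndsOnWave l ∧ i ≤ μ l).image (fun l => (G.barEnd l).1) ⊆
      (G.highSubgraphs μ i).biUnion fun g => Finset.univ.biUnion fun s =>
        Finset.univ.filter fun v : V => G.kind v = .wave s ∧ ∃ l ∈ g, G.Incident l v := by
    intro v hv
    obtain ⟨l, hl, rfl⟩ := Finset.mem_image.1 hv
    obtain ⟨⟨s, hs⟩, hi⟩ := (Finset.mem_filter.1 hl).2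
    obtain ⟨g, hg, hlg⟩ := exists_highSubgraph (G := G) hi
    simp only [Finset.mem_biUnion, Finset.mem_filter, Finset.mem_univ, true_and]
    exact ⟨g, hg, s, hs, l, hlg, Or.inr rfl⟩
  rw [← Finset.card_image_of_injOn hinj]
  refine (Finset.card_le_card h).trans (Finset.card_biUnion_le.trans
    (Finset.sum_le_sum fun g _ => Finset.card_biUnion_le.trans (le_of_eq ?_)))
  exact Finset.sum_congr rfl fun s _ => by rw [waveCount]

end TensorGraph

lemma sum_range_card_filter_le {α : Type*} (A : Finset α) (k : α → ℕ) {Λ : ℕ}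
    (hk : ∀ x ∈ A, k x ≤ Λ) :
    ∑ i ∈ Finset.range (Λ + 1), (A.filter fun x => i ≤ k x).card = ∑ x ∈ A, (k x + 1) := by
  simp_rw [Finset.card_filter]
  rw [Finset.sum_comm]
  refine Finset.sum_congr rfl fun x hx => ?_
  rw [← Finset.card_filter]
  have : (Finset.range (Λ + 1)).filter (fun i => i ≤ k x) = Finset.range (k x + 1) := by
    ext i
    have := hk x hx
    simp only [Finset.mem_filter, Finset.mem_range]
    omega
  rw [this, Finset.card_range]

lemma prod_zpow_eq_zpow_sum {α : Type*} {x : ℝ} (hx : x ≠ 0) (A : Finset α) (k : α → ℤ) :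
    ∏ i ∈ A, x ^ k i = x ^ ∑ i ∈ A, k i := by
  classical
  induction A using Finset.induction_on with
  | empty => simp
  | insert i A hi ih => rw [Finset.prod_insert hi, Finset.sum_insert hi, zpow_add₀ hx, ih]

namespace TensorGraph

variable {V L : Type*} {G : TensorGraph V L} [Fintype V] [Fintype L]

open Classical in
/-- The power counting, read scale by scale: a line of scale `k` lies in a high subgraph for each of
the scales `0, …, k`, as does a closed face whose lowest line has scale `k`. -/
lemma le_prod_highSubgraphs {M : ℕ} (hM : 2 ≤ M) {μ : L → ℕ} {Λ : ℕ} (hμ : ∀ l, μ l ≤ Λ)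
    {ρ : G.internalFaces → L} (hρ : ∀ F, ρ F ∈ F.1.2 ∧ ∀ l ∈ F.1.2, μ (ρ F) ≤ μ l) :
    (∏ l, ((M : ℝ)⁻¹ ^ (μ l + 1) * if G.EndsOnWave l then (M : ℝ) ^ (μ l + 1) else 1)) *
        ∏ F, (M : ℝ) ^ (μ (ρ F) + 1) ≤
      ∏ i ∈ Finset.range (Λ + 1), ∏ g ∈ G.highSubgraphs μ i, (M : ℝ) ^ G.divergenceDegree g := by
  have hM0 : (M : ℝ) ≠ 0 := by positivity
  have hM1 : (1 : ℝ) ≤ M := by exact_mod_cast (by omega : 1 ≤ M)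
  have hl := sum_range_card_filter_le Finset.univ μ (fun l _ => hμ l)
  have hF := sum_range_card_filter_le Finset.univ (fun F => μ (ρ F)) (fun F _ => hμ (ρ F))
  have hW := sum_range_card_filter_le (Finset.univ.filter G.EndsOnWave) μ (fun l _ => hμ l)
  simp_rw [Finset.filter_filter] at hW
  have e : (∏ l, ((M : ℝ)⁻¹ ^ (μ l + 1) * if G.EndsOnWave l then (M : ℝ) ^ (μ l + 1) else 1)) *
      ∏ F, (M : ℝ) ^ (μ (ρ F) + 1) =
      (M : ℝ) ^ (-((∑ l, (μ l + 1) : ℕ) : ℤ) + ((∑ F, (μ (ρ F) + 1) : ℕ) : ℤ) +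
        ((∑ l with G.EndsOnWave l, (μ l + 1) : ℕ) : ℤ)) := by
    rw [Finset.prod_mul_distrib, ← Finset.prod_filter, Finset.prod_pow_eq_pow_sum,
      Finset.prod_pow_eq_pow_sum, Finset.prod_pow_eq_pow_sum, zpow_add₀ hM0, zpow_add₀ hM0,
      zpow_neg, zpow_natCast, zpow_natCast, zpow_natCast, inv_pow]
    ring
  rw [e]
  simp_rw [prod_zpow_eq_zpow_sum hM0]
  refine zpow_le_zpow_right₀ hM1 ?_
  rw [← hl, ← hF, ← hW]
  push_cast
  rw [← Finset.sum_neg_distrib, ← Finset.sum_add_distrib, ← Finset.sum_add_distrib]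
  refine Finset.sum_le_sum fun i _ => ?_
  simp only [divergenceDegree, Finset.sum_add_distrib, Finset.sum_neg_distrib]
  have h1 := sum_card_highSubgraphs_le (G := G) μ i
  have h2 := card_high_faces_le hρ i
  have h3 := card_high_waves_le (G := G) μ i
  rw [← Nat.cast_le (α := ℤ)] at h1 h2 h3
  simp only [Nat.cast_sum] at h1 h2 h3
  linarith

end TensorGraph


/-! ### Momentum configurations -/

/-- The momentum that a vertex multiplies by, read off on its `φ̄`-legs; `n` is the momentum of
such a leg. -/
def VertexKind.momentumFactor : VertexKind → (Fin 3 → ℤ) → ℝ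
  | .wave s, n => |(n s : ℝ)|
  | _, _ => 1

lemma VertexKind.momentumFactor_nonneg (k : VertexKind) (n : Fin 3 → ℤ) :
    0 ≤ k.momentumFactor n := by
  cases k <;> simp [momentumFactor]

lemma VertexKind.momentumFactor_mul_decay_le_one (k : VertexKind) (n : Fin 3 → ℤ) :
    k.momentumFactor n * ∏ s, ((1 + |(n s : ℝ)|) ^ 2)⁻¹ ≤ 1 := by
  have h1 : ∀ s, (1 : ℝ) ≤ (1 + |(n s : ℝ)|) ^ 2 := fun s =>
    one_le_pow₀ (by linarith [abs_nonneg (n s : ℝ)])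
  rw [Finset.prod_inv_distrib, ← div_eq_mul_inv,
    div_le_one (Finset.prod_pos fun s _ => by positivity)]
  have h2 : (1 : ℝ) ≤ ∏ s, (1 + |(n s : ℝ)|) ^ 2 := Finset.one_le_prod fun s _ => h1 s
  cases k with
  | quartic c => exact h2
  | mass => exact h2
  | wave r =>
    have h3 : (1 + |(n r : ℝ)|) ^ 2 ≤ ∏ s, (1 + |(n s : ℝ)|) ^ 2 := by
      rw [← Finset.mul_prod_erase _ _ (Finset.mem_univ r)]
      exact le_mul_of_one_le_right (by positivity) (Finset.one_le_prod fun s _ => h1 s)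
    refine le_trans ?_ h3
    simp only [momentumFactor]
    nlinarith [abs_nonneg (n r : ℝ), sq_nonneg (n r : ℝ), sq_nonneg (|(n r : ℝ)|)]

lemma VertexKind.weight_eq_prod (k : VertexKind) (p q : Fin k.arity → Fin 3 → ℤ)
    (h : ∀ j s, p j s = q (k.strandPerm s j) s) : k.weight p = ∏ j, k.momentumFactor (q j) := by
  cases k with
  | quartic c => simp [weight, momentumFactor]
  | mass => simp [weight, momentumFactor]
  | wave s =>
    have h0 : p (0 : Fin 1) s = q (0 : Fin 1) s := h (0 : Fin 1) s
    simp only [weight, momentumFactor, h0]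
    exact (Fin.prod_univ_one fun j : Fin 1 => |(q j s : ℝ)|).symm

namespace TensorGraph

variable {V L : Type*} (G : TensorGraph V L)

/-- The momenta at which the integrand does not vanish: the momentum of each strand is conserved
through the vertices and along the lines. -/
def Conserved : Set ((G.Leg → Fin 3 → ℤ) × (G.Leg → Fin 3 → ℤ)) :=
  {pq | (∀ h s, pq.1 h s = pq.2 (G.through s h) s) ∧ ∀ l, pq.1 (G.phiEnd l) = pq.2 (G.barEnd l)}

variable {G}

lemma Conserved.eq_of_next {pq : (G.Leg → Fin 3 → ℤ) × (G.Leg → Fin 3 → ℤ)}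
    (h : pq ∈ G.Conserved) {s : Fin 3} {l l' : L} (hl : G.Next s l l') :
    pq.1 (G.phiEnd l') s = pq.1 (G.phiEnd l) s := by
  rw [h.1, h.2, show G.through s (G.phiEnd l') = G.barEnd l from hl]

/-- Conserved momenta are determined by their values on the external `φ`-legs and on one line of
each closed face: a strand on which two configurations differ can be followed forever, so that it
closes up, and then they agree on the chosen line of the face. -/
lemma Conserved.eq_of_agree [Fintype L] {ρ : G.internalFaces → L} (hρ : ∀ F, ρ F ∈ F.1.2)
    {pq pq' : (G.Leg → Fin 3 → ℤ) × (G.Leg → Fin 3 → ℤ)} (h : pq ∈ G.Conserved)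
    (h' : pq' ∈ G.Conserved)
    (hF : ∀ F, pq.1 (G.phiEnd (ρ F)) F.1.1 = pq'.1 (G.phiEnd (ρ F)) F.1.1)
    (hext : ∀ e, e ∉ Set.range G.phiEnd → pq.1 e = pq'.1 e) : pq = pq' := by
  classical
  have hp : ∀ e s, pq.1 e s = pq'.1 e s := by
    intro e s
    by_cases he : e ∈ Set.range G.phiEnd
    swap
    · rw [hext e he]
    obtain ⟨l, rfl⟩ := he
    by_contra hne
    let D := {l : L // pq.1 (G.phiEnd l) s ≠ pq'.1 (G.phiEnd l) s}
    have hnext : ∀ l : D, ∃ l' : D, G.Next s l.1 l'.1 := by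
      rintro ⟨l, hl⟩
      obtain ⟨e, he⟩ := (G.through_bijective s).2 (G.barEnd l)
      have e1 : pq.1 e s = pq.1 (G.phiEnd l) s := by rw [h.1, h.2, he]
      have e2 : pq'.1 e s = pq'.1 (G.phiEnd l) s := by rw [h'.1, h'.2, he]
      have hne' : pq.1 e s ≠ pq'.1 e s := by rwa [e1, e2]
      obtain ⟨l', rfl⟩ : e ∈ Set.range G.phiEnd := by
        by_contra he'
        exact hne' (by rw [hext e he'])
      exact ⟨⟨l', hne'⟩, he⟩
    choose nxt hnxt using hnext
    have hinj : Function.Injective nxt := by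
      intro x y hxy
      have hy := hnxt y
      rw [← hxy] at hy
      exact Subtype.ext ((hnxt x).left_unique hy)
    have hiter : ∀ (k : ℕ) (x : D), Relation.TransGen (G.Next s) x.1 (nxt^[k + 1] x).1 := by
      intro k
      induction k with
      | zero => exact fun x => .single (hnxt x)
      | succ k ih =>
        intro x
        rw [Function.iterate_succ_apply']
        exact (ih x).tail (hnxt _)
    obtain ⟨k, hk0, hk⟩ := hinj.mem_periodicPts ⟨l, hne⟩
    have hcyc : Relation.TransGen (G.Next s) l l := by
      have := hiter (k - 1) ⟨l, hne⟩
      rwa [Nat.sub_add_cancel hk0, hk.eq] at this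
    let F : G.internalFaces :=
      ⟨(s, Finset.univ.filter fun l' => Relation.ReflTransGen (G.Next s) l l'),
        mem_internalFaces.2 ⟨l, hcyc, fun l' => by simp⟩⟩
    have hconst : ∀ {r : (G.Leg → Fin 3 → ℤ) × (G.Leg → Fin 3 → ℤ)}, r ∈ G.Conserved → ∀ l',
        Relation.ReflTransGen (G.Next s) l l' → r.1 (G.phiEnd l') s = r.1 (G.phiEnd l) s := by
      intro r hr l' hl'
      induction hl' with
      | refl => rfl
      | tail _ hbc ih => rw [Conserved.eq_of_next hr hbc, ih]
    have hmem : Relation.ReflTransGen (G.Next s) l (ρ F) := by simpa [F] using hρ F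
    exact hne (by rw [← hconst h _ hmem, ← hconst h' _ hmem]; exact hF F)
  refine Prod.ext (funext fun e => funext (hp e)) (funext fun e => funext fun s => ?_)
  obtain ⟨e, rfl⟩ := (G.through_bijective s).2 e
  rw [← h.1, ← h'.1, hp]

variable [Fintype V] [Fintype L]

lemma integrand_eq_zero {M : ℕ} {a : Fin 3 → ℝ} {m : ℝ} {μ : L → ℕ}
    {f g : G.Leg → UnitAddTorus (Fin 3) → ℂ} {pq : (G.Leg → Fin 3 → ℤ) × (G.Leg → Fin 3 → ℤ)}
    (h : pq ∉ G.Conserved) : G.integrand M a m μ f g pq = 0 := by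
  classical
  simp only [Conserved, Set.mem_ofPred_eq, not_and_or, not_forall] at h
  rcases h with ⟨⟨v, j⟩, s, h⟩ | ⟨l, h⟩
  · have : (G.kind v).kernel (fun j => pq.1 ⟨v, j⟩) (fun j => pq.2 ⟨v, j⟩) = 0 := by
      rw [VertexKind.kernel, Finset.prod_eq_zero (Finset.mem_univ j)
        (Finset.prod_eq_zero (Finset.mem_univ s) (if_neg h)), mul_zero]
    rw [integrand, Finset.prod_eq_zero (i := v) (f := fun v => (((G.kind v).kernel
      (fun j => pq.1 ⟨v, j⟩) (fun j => pq.2 ⟨v, j⟩) : ℝ) : ℂ)) (Finset.mem_univ v) (by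
        rw [this, Complex.ofReal_zero])]
    simp
  · obtain ⟨s, hs⟩ := Function.ne_iff.1 h
    have : propagator M a m (μ l) (pq.1 (G.phiEnd l)) (pq.2 (G.barEnd l)) = 0 := by
      rw [propagator, Finset.prod_eq_zero (Finset.mem_univ s) (if_neg hs), mul_zero]
    rw [integrand, Finset.prod_eq_zero (i := l) (f := fun l => ((propagator M a m (μ l)
      (pq.1 (G.phiEnd l)) (pq.2 (G.barEnd l)) : ℝ) : ℂ)) (Finset.mem_univ l) (by
        rw [this, Complex.ofReal_zero])]
    simp

open Classical in
/-- The momentum factors of the wave-function vertices are attributed to the `φ̄`-legs, hence to the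
line or the test function found there. -/
lemma norm_integrand_eq {M : ℕ} {a : Fin 3 → ℝ} {m : ℝ} {μ : L → ℕ}
    (hslice : ∀ i p, 0 ≤ slice M a m i p)
    {f g : G.Leg → UnitAddTorus (Fin 3) → ℂ} {pq : (G.Leg → Fin 3 → ℤ) × (G.Leg → Fin 3 → ℤ)}
    (h : pq ∈ G.Conserved) :
    ‖G.integrand M a m μ f g pq‖ =
      (∏ l, slice M a m (μ l) (pq.1 (G.phiEnd l)) *
        (G.kind (G.barEnd l).1).momentumFactor (pq.1 (G.phiEnd l))) *
      (∏ e with e ∉ Set.range G.phiEnd, ‖mFourierCoeff (f e) (pq.1 e)‖) *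
      ∏ e with e ∉ Set.range G.barEnd,
        (‖mFourierCoeff (g e) (pq.2 e)‖ * (G.kind e.1).momentumFactor (pq.2 e)) := by
  have h1 : ∀ l, propagator M a m (μ l) (pq.1 (G.phiEnd l)) (pq.2 (G.barEnd l)) =
      slice M a m (μ l) (pq.1 (G.phiEnd l)) := by
    intro l
    rw [propagator, h.2]
    simp
  have h2 : ∀ v, (G.kind v).kernel (fun j => pq.1 ⟨v, j⟩) (fun j => pq.2 ⟨v, j⟩) =
      ∏ j, (G.kind v).momentumFactor (pq.2 ⟨v, j⟩) := by
    intro v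
    have hv : ∀ j s, pq.1 ⟨v, j⟩ s = pq.2 ⟨v, (G.kind v).strandPerm s j⟩ s :=
      fun j s => h.1 ⟨v, j⟩ s
    rw [VertexKind.kernel, Finset.prod_eq_one fun j _ => Finset.prod_eq_one fun s _ =>
      if_pos (hv j s), mul_one]
    exact (G.kind v).weight_eq_prod _ (fun j => pq.2 ⟨v, j⟩) hv
  have h3 : ∏ v, ∏ j, (G.kind v).momentumFactor (pq.2 ⟨v, j⟩) =
      (∏ l, (G.kind (G.barEnd l).1).momentumFactor (pq.1 (G.phiEnd l))) *
      ∏ e with e ∉ Set.range G.barEnd, (G.kind e.1).momentumFactor (pq.2 e) := by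
    rw [← Fintype.prod_sigma' (fun v j => (G.kind v).momentumFactor (pq.2 ⟨v, j⟩)),
      ← Finset.prod_filter_mul_prod_filter_not Finset.univ (· ∈ Set.range G.barEnd)]
    congr 1
    have : Finset.univ.filter (· ∈ Set.range G.barEnd) = Finset.univ.image G.barEnd := by
      ext e
      simp
    rw [this, Finset.prod_image fun _ _ _ _ => fun h => G.barEnd_injective h]
    exact Finset.prod_congr rfl fun l _ => by rw [h.2]
  have h4 : ∀ v, ‖((G.kind v).kernel (fun j => pq.1 ⟨v, j⟩) (fun j => pq.2 ⟨v, j⟩) : ℂ)‖ =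
      ∏ j, (G.kind v).momentumFactor (pq.2 ⟨v, j⟩) := fun v => by
    rw [h2, Complex.norm_of_nonneg (Finset.prod_nonneg fun j _ =>
      VertexKind.momentumFactor_nonneg _ _)]
  rw [integrand, norm_mul, norm_mul, norm_mul, norm_prod, norm_prod, norm_prod, norm_prod,
    Finset.prod_congr rfl fun v _ => h4 v, h3, Finset.prod_mul_distrib, Finset.prod_mul_distrib]
  simp only [h1, Complex.norm_of_nonneg (hslice _ _), RCLike.norm_conj]
  ring

end TensorGraph


/-! ### Power counting -/

namespace TensorGraph

variable {V L : Type*} {G : TensorGraph V L} [Fintype V] [Fintype L]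

omit [Fintype L] in
lemma card_leg_le (G : TensorGraph V L) : Fintype.card G.Leg ≤ 2 * Fintype.card V := by
  rw [Fintype.card_sigma, mul_comm, ← smul_eq_mul]
  refine Finset.sum_le_card_nsmul _ _ _ fun v _ => ?_
  rw [Fintype.card_fin]
  cases G.kind v <;> simp [VertexKind.arity]

lemma card_line_le (G : TensorGraph V L) : Fintype.card L ≤ 2 * Fintype.card V :=
  (Fintype.card_le_of_injective _ G.phiEnd_injective).trans G.card_leg_le

lemma card_internalFaces_le (G : TensorGraph V L) :
    Fintype.card G.internalFaces ≤ 6 * Fintype.card V := by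
  obtain ⟨ρ, hρ⟩ := G.exists_lowest_line fun _ => 0
  have h := Fintype.card_le_of_injective _ (lowest_line_injective (μ := fun _ => 0) hρ)
  rw [Fintype.card_prod, Fintype.card_fin] at h
  have := G.card_line_le
  omega

/-- The weight of the momentum of a closed face, or of a strand leaving at an external `φ`-leg. -/
def strandWeight (M : ℕ) (c : ℝ) (μ : L → ℕ) (ρ : G.internalFaces → L) :
    G.internalFaces ⊕ {e : G.Leg // e ∉ Set.range G.phiEnd} × Fin 3 → ℤ → ℝ
  | .inl F, n => Real.exp (-(c * (M : ℝ)⁻¹ ^ μ (ρ F)) * |(n : ℝ)|)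
  | .inr _, n => ((1 + |(n : ℝ)|) ^ 2)⁻¹

omit [Fintype V] in
lemma strandWeight_nonneg {M : ℕ} {c : ℝ} {μ : L → ℕ} {ρ : G.internalFaces → L} (r) (n : ℤ) :
    0 ≤ strandWeight M c μ ρ r n := by
  rcases r with F | e
  · exact (Real.exp_pos _).le
  · exact inv_nonneg.2 (sq_nonneg _)

/-- The momenta of the closed faces and of the strands leaving at external `φ`-legs. -/
def strandMomenta (ρ : G.internalFaces → L)
    (pq : (G.Leg → Fin 3 → ℤ) × (G.Leg → Fin 3 → ℤ)) :
    G.internalFaces ⊕ {e : G.Leg // e ∉ Set.range G.phiEnd} × Fin 3 → ℤ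
  | .inl F => pq.1 (G.phiEnd (ρ F)) F.1.1
  | .inr e => pq.1 e.1 e.2

omit [Fintype V] in
lemma strandMomenta_injOn {μ : L → ℕ} {ρ : G.internalFaces → L}
    (hρ : ∀ F, ρ F ∈ F.1.2 ∧ ∀ l ∈ F.1.2, μ (ρ F) ≤ μ l) :
    G.Conserved.InjOn (strandMomenta ρ) := by
  intro pq h pq' h' he
  refine Conserved.eq_of_agree (fun F => (hρ F).1) h h' (fun F => congrFun he (.inl F))
    fun e hne => funext fun s => congrFun he (.inr (⟨e, hne⟩, s))

omit [Fintype V] in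
/-- Of the exponential decay of all lines only that of the lowest lines of the closed faces is
kept. -/
lemma prod_line_decay_le {M : ℕ} {c : ℝ} (hc : 0 < c) {μ : L → ℕ} {ρ : G.internalFaces → L}
    (hρ : ∀ F, ρ F ∈ F.1.2 ∧ ∀ l ∈ F.1.2, μ (ρ F) ≤ μ l) (p : G.Leg → Fin 3 → ℤ) :
    ∏ l, ∏ s, Real.exp (-(c * (M : ℝ)⁻¹ ^ μ l) * |(p (G.phiEnd l) s : ℝ)|) ≤
      ∏ F, Real.exp (-(c * (M : ℝ)⁻¹ ^ μ (ρ F)) * |(p (G.phiEnd (ρ F)) F.1.1 : ℝ)|) := by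
  classical
  let w : L × Fin 3 → ℝ := fun x =>
    Real.exp (-(c * (M : ℝ)⁻¹ ^ μ x.1) * |(p (G.phiEnd x.1) x.2 : ℝ)|)
  have hw1 : ∀ x, w x ≤ 1 := fun x => Real.exp_le_one_iff.2 (by
    have : 0 ≤ c * (M : ℝ)⁻¹ ^ μ x.1 * |(p (G.phiEnd x.1) x.2 : ℝ)| := by positivity
    linarith)
  have hw0 : ∀ x, 0 ≤ w x := fun x => (Real.exp_pos _).le
  calc _ = ∏ x, w x := (Fintype.prod_prod_type w).symm
    _ ≤ ∏ x ∈ Finset.univ.image fun F : G.internalFaces => (ρ F, F.1.1), w x :=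
      Finset.prod_le_prod_of_subset_of_le_one (Finset.subset_univ _) (fun x _ => hw0 x)
        fun x _ _ => hw1 x
    _ = _ := Finset.prod_image fun F _ F' _ h => lowest_line_injective hρ h

open Classical in
/-- The part of the bound on a line that does not depend on its momentum. -/
def lineFactor (G : TensorGraph V L) (M : ℕ) (μ : L → ℕ) (l : L) : ℝ :=
  (M : ℝ)⁻¹ ^ μ l * if G.EndsOnWave l then (M : ℝ) ^ μ l else 1

omit [Fintype V] [Fintype L] in
lemma lineFactor_nonneg (M : ℕ) (μ : L → ℕ) (l : L) : 0 ≤ G.lineFactor M μ l := by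
  unfold lineFactor
  split_ifs <;> positivity

omit [Fintype V] [Fintype L] in
lemma lineFactor_le {M : ℕ} (hM : 2 ≤ M) (μ : L → ℕ) (l : L) [Decidable (G.EndsOnWave l)] :
    G.lineFactor M μ l ≤ M *
      ((M : ℝ)⁻¹ ^ (μ l + 1) * if G.EndsOnWave l then (M : ℝ) ^ (μ l + 1) else 1) := by
  have hM0 : (M : ℝ) ≠ 0 := by positivity
  have hM1 : (1 : ℝ) ≤ M := by exact_mod_cast (by omega : 1 ≤ M)
  have h : (M : ℝ) * (M : ℝ)⁻¹ ^ (μ l + 1) = (M : ℝ)⁻¹ ^ μ l := by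
    rw [pow_succ]
    field_simp
  rw [← mul_assoc, h, lineFactor]
  refine mul_le_mul_of_nonneg_left ?_ (by positivity)
  by_cases hl : G.EndsOnWave l
  · simpa only [if_pos hl] using pow_le_pow_right₀ hM1 (Nat.le_succ _)
  · simp only [if_neg hl, le_refl]

omit [Fintype V] [Fintype L] in
lemma slice_mul_momentumFactor_le {M : ℕ} (hM : 2 ≤ M) {a : Fin 3 → ℝ} {m K c : ℝ}
    (hK : ∀ i p, 0 ≤ slice M a m i p ∧
      slice M a m i p ≤
        K * (M : ℝ)⁻¹ ^ i * ∏ s, Real.exp (-(c * (M : ℝ)⁻¹ ^ i) * |(p s : ℝ)|) ∧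
      ∀ r, slice M a m i p * |(p r : ℝ)| ≤
        K * ∏ s, Real.exp (-(c * (M : ℝ)⁻¹ ^ i) * |(p s : ℝ)|))
    (μ : L → ℕ) (l : L) (n : Fin 3 → ℤ) :
    slice M a m (μ l) n * (G.kind (G.barEnd l).1).momentumFactor n ≤
      K * G.lineFactor M μ l * ∏ s, Real.exp (-(c * (M : ℝ)⁻¹ ^ μ l) * |(n s : ℝ)|) := by
  have hM0 : (M : ℝ) ≠ 0 := by positivity
  obtain ⟨-, h1, h2⟩ := hK (μ l) n
  unfold lineFactor
  cases h : G.kind (G.barEnd l).1 with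
  | quartic c => simpa [EndsOnWave, h, VertexKind.momentumFactor] using h1
  | mass => simpa [EndsOnWave, h, VertexKind.momentumFactor] using h1
  | wave s =>
    have hl : G.EndsOnWave l := ⟨s, h⟩
    rw [if_pos hl, ← mul_pow, inv_mul_cancel₀ hM0, one_pow, mul_one]
    exact h2 s

open Classical in
lemma norm_integrand_le {M : ℕ} (hM : 2 ≤ M) {a : Fin 3 → ℝ} {m K c B : ℝ} (hK1 : 1 ≤ K)
    (hc : 0 < c) (hK : ∀ i p, 0 ≤ slice M a m i p ∧
      slice M a m i p ≤
        K * (M : ℝ)⁻¹ ^ i * ∏ s, Real.exp (-(c * (M : ℝ)⁻¹ ^ i) * |(p s : ℝ)|) ∧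
      ∀ r, slice M a m i p * |(p r : ℝ)| ≤
        K * ∏ s, Real.exp (-(c * (M : ℝ)⁻¹ ^ i) * |(p s : ℝ)|)) (hB1 : 1 ≤ B)
    {f g : G.Leg → UnitAddTorus (Fin 3) → ℂ}
    (hf : ∀ e n, ‖mFourierCoeff (f e) n‖ ≤ B * ∏ s, ((1 + |(n s : ℝ)|) ^ 2)⁻¹)
    (hg : ∀ e n, ‖mFourierCoeff (g e) n‖ ≤ B * ∏ s, ((1 + |(n s : ℝ)|) ^ 2)⁻¹)
    {μ : L → ℕ} {ρ : G.internalFaces → L}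
    (hρ : ∀ F, ρ F ∈ F.1.2 ∧ ∀ l ∈ F.1.2, μ (ρ F) ≤ μ l)
    {pq : (G.Leg → Fin 3 → ℤ) × (G.Leg → Fin 3 → ℤ)} (h : pq ∈ G.Conserved) :
    ‖G.integrand M a m μ f g pq‖ ≤
      K ^ (2 * Fintype.card V) * B ^ (4 * Fintype.card V) * (∏ l, G.lineFactor M μ l) *
        ∏ r, strandWeight M c μ ρ r (strandMomenta ρ pq r) := by
  have hB0 : 0 ≤ B := by linarith
  have hK0 : 0 ≤ K := by linarith
  rw [norm_integrand_eq (fun i p => (hK i p).1) h]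
  set T : ℝ := ∏ l, ∏ s, Real.exp (-(c * (M : ℝ)⁻¹ ^ μ l) * |(pq.1 (G.phiEnd l) s : ℝ)|) with hT
  set W : ℝ := ∏ e with e ∉ Set.range G.phiEnd, ∏ s, ((1 + |(pq.1 e s : ℝ)|) ^ 2)⁻¹ with hW
  have hT0 : 0 ≤ T := Finset.prod_nonneg fun _ _ => Finset.prod_nonneg fun _ _ => by positivity
  have hW0 : 0 ≤ W := Finset.prod_nonneg fun _ _ => Finset.prod_nonneg fun _ _ => by positivity
  have hP0 : 0 ≤ ∏ l, G.lineFactor M μ l := Finset.prod_nonneg fun l _ => lineFactor_nonneg M μ l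
  have hcard : ∀ A : Finset G.Leg, B ^ A.card ≤ B ^ (2 * Fintype.card V) := fun A =>
    pow_le_pow_right₀ hB1 ((Finset.card_le_univ A).trans G.card_leg_le)
  have h1 : ∏ l, slice M a m (μ l) (pq.1 (G.phiEnd l)) *
      (G.kind (G.barEnd l).1).momentumFactor (pq.1 (G.phiEnd l)) ≤
      K ^ (2 * Fintype.card V) * (∏ l, G.lineFactor M μ l) * T := by
    calc _ ≤ ∏ l, (K * G.lineFactor M μ l *
          ∏ s, Real.exp (-(c * (M : ℝ)⁻¹ ^ μ l) * |(pq.1 (G.phiEnd l) s : ℝ)|)) :=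
          Finset.prod_le_prod (fun l _ => mul_nonneg (hK _ _).1
            (VertexKind.momentumFactor_nonneg _ _))
            fun l _ => slice_mul_momentumFactor_le hM hK μ l _
      _ = K ^ Fintype.card L * (∏ l, G.lineFactor M μ l) * T := by
        rw [Finset.prod_mul_distrib, Finset.prod_mul_distrib, Finset.prod_const, Finset.card_univ]
      _ ≤ _ := by
        gcongr
        exact G.card_line_le
  have h2 : ∏ e with e ∉ Set.range G.phiEnd, ‖mFourierCoeff (f e) (pq.1 e)‖ ≤
      B ^ (2 * Fintype.card V) * W := by
    calc _ ≤ ∏ e with e ∉ Set.range G.phiEnd, (B * ∏ s, ((1 + |(pq.1 e s : ℝ)|) ^ 2)⁻¹) :=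
          Finset.prod_le_prod (fun _ _ => norm_nonneg _) fun e _ => hf e _
      _ ≤ _ := by
        rw [Finset.prod_mul_distrib, Finset.prod_const]
        exact mul_le_mul_of_nonneg_right (hcard _) hW0
  have h3 : ∏ e with e ∉ Set.range G.barEnd,
      (‖mFourierCoeff (g e) (pq.2 e)‖ * (G.kind e.1).momentumFactor (pq.2 e)) ≤
      B ^ (2 * Fintype.card V) := by
    calc _ ≤ ∏ e : G.Leg with e ∉ Set.range G.barEnd, B := by
          refine Finset.prod_le_prod (fun _ _ => mul_nonneg (norm_nonneg _)
            (VertexKind.momentumFactor_nonneg _ _)) fun e _ => ?_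
          calc _ ≤ B * (∏ s, ((1 + |(pq.2 e s : ℝ)|) ^ 2)⁻¹) *
                (G.kind e.1).momentumFactor (pq.2 e) :=
                mul_le_mul_of_nonneg_right (hg e _) (VertexKind.momentumFactor_nonneg _ _)
            _ = B * ((G.kind e.1).momentumFactor (pq.2 e) *
                ∏ s, ((1 + |(pq.2 e s : ℝ)|) ^ 2)⁻¹) := by ring
            _ ≤ B := mul_le_of_le_one_right hB0
                (VertexKind.momentumFactor_mul_decay_le_one _ _)
      _ ≤ _ := by
        rw [Finset.prod_const]
        exact hcard _
  have h4 : T * W ≤ ∏ r, strandWeight M c μ ρ r (strandMomenta ρ pq r) := by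
    rw [Fintype.prod_sum_type, Fintype.prod_prod_type]
    refine mul_le_mul (prod_line_decay_le hc hρ pq.1) (le_of_eq ?_) hW0
      (Finset.prod_nonneg fun _ _ => (Real.exp_pos _).le)
    exact Finset.prod_subtype _ (fun e => by simp) fun e => ∏ s, ((1 + |(pq.1 e s : ℝ)|) ^ 2)⁻¹
  calc _ ≤ K ^ (2 * Fintype.card V) * (∏ l, G.lineFactor M μ l) * T *
        (B ^ (2 * Fintype.card V) * W) * B ^ (2 * Fintype.card V) := by
        refine mul_le_mul (mul_le_mul h1 h2 ?_ (by positivity)) h3 ?_ (by positivity)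
        · exact Finset.prod_nonneg fun _ _ => norm_nonneg _
        · exact Finset.prod_nonneg fun _ _ => mul_nonneg (norm_nonneg _)
            (VertexKind.momentumFactor_nonneg _ _)
    _ = K ^ (2 * Fintype.card V) * B ^ (4 * Fintype.card V) * (∏ l, G.lineFactor M μ l) *
        (T * W) := by ring
    _ ≤ _ := mul_le_mul_of_nonneg_left h4 (by positivity)

open Classical in
lemma prod_tsum_strandWeight_le {M : ℕ} (hM : 2 ≤ M) {c : ℝ} (hc : 0 < c) (μ : L → ℕ)
    (ρ : G.internalFaces → L) :
    ∏ r, ∑' n, strandWeight M c μ ρ r n ≤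
      (2 + 2 / c) ^ (6 * Fintype.card V) *
        (max 1 (∑' n : ℤ, ((1 + |(n : ℝ)|) ^ 2)⁻¹)) ^ (6 * Fintype.card V) *
        ∏ F, (M : ℝ) ^ (μ (ρ F) + 1) := by
  have hM1 : (1 : ℝ) ≤ M := by exact_mod_cast (by omega : 1 ≤ M)
  have hc1 : 1 ≤ 2 + 2 / c := by
    have : 0 < 2 / c := by positivity
    linarith
  set S : ℝ := max 1 (∑' n : ℤ, ((1 + |(n : ℝ)|) ^ 2)⁻¹) with hS
  have hS1 : 1 ≤ S := le_max_left _ _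
  rw [Fintype.prod_sum_type]
  have h1 : ∏ F : G.internalFaces, ∑' n, strandWeight M c μ ρ (.inl F) n ≤
      (2 + 2 / c) ^ (6 * Fintype.card V) * ∏ F, (M : ℝ) ^ (μ (ρ F) + 1) := by
    calc _ ≤ ∏ F : G.internalFaces, ((2 + 2 / c) * (M : ℝ) ^ (μ (ρ F) + 1)) := by
          refine Finset.prod_le_prod (fun F _ => tsum_nonneg (strandWeight_nonneg _))
            fun F _ => (tsum_exp_scale_le hM hc _).trans ?_
          gcongr
          exact Nat.le_succ _
      _ ≤ _ := by
        rw [Finset.prod_mul_distrib, Finset.prod_const, Finset.card_univ]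
        gcongr
        exact G.card_internalFaces_le
  have h2 : ∏ e : {e : G.Leg // e ∉ Set.range G.phiEnd} × Fin 3,
      ∑' n, strandWeight M c μ ρ (.inr e) n ≤ S ^ (6 * Fintype.card V) := by
    calc _ ≤ ∏ _e : {e : G.Leg // e ∉ Set.range G.phiEnd} × Fin 3, S :=
          Finset.prod_le_prod (fun e _ => tsum_nonneg (strandWeight_nonneg _)) fun e _ => le_max_right _ _
      _ ≤ _ := by
        rw [Finset.prod_const, Finset.card_univ]
        refine pow_le_pow_right₀ hS1 ?_
        rw [Fintype.card_prod, Fintype.card_fin]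
        have h := Fintype.card_subtype_le fun e : G.Leg => e ∉ Set.range G.phiEnd
        have := G.card_leg_le
        omega
  calc _ ≤ ((2 + 2 / c) ^ (6 * Fintype.card V) * ∏ F, (M : ℝ) ^ (μ (ρ F) + 1)) *
        S ^ (6 * Fintype.card V) := by
        exact mul_le_mul h1 h2 (Finset.prod_nonneg fun e _ => tsum_nonneg (strandWeight_nonneg _))
          (by positivity)
    _ = _ := by ring

omit [Fintype V] in
lemma summable_strandWeight {M : ℕ} (hM : 2 ≤ M) {c : ℝ} (hc : 0 < c) (μ : L → ℕ)
    (ρ : G.internalFaces → L) (r) : Summable (strandWeight M c μ ρ r) := by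
  cases r with
  | inl F => exact (summable_exp_neg_mul_abs (by positivity)).1
  | inr e => exact summable_inv_one_add_abs_sq

end TensorGraph

end TensorModel

end

theorem mainTheorem7 (M : ℕ) (hM : 2 ≤ M) (a : Fin 3 → ℝ) (ha : ∀ s, 0 < a s)
    (m : ℝ) (hm : 0 < m) {J : Type*} (f : J → UnitAddTorus (Fin 3) → ℂ)
    (hf : ∀ j, ContDiff ℝ ∞ (TensorModel.lift (f j)))
    (hfb : ∀ k : ℕ, ∃ B : ℝ, ∀ j x, ‖iteratedFDeriv ℝ k (TensorModel.lift (f j)) x‖ ≤ B) :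
    ∃ K : ℝ, 0 < K ∧
      ∀ (V L : Type*) [Fintype V] [Fintype L] (G : TensorModel.TensorGraph V L), G.Connected →
      ∀ (jφ jbar : G.Leg → J) (Λ : ℕ) (μ : L → ℕ), (∀ l, μ l ≤ Λ) →
        Summable (G.integrand M a m μ (fun h => f (jφ h)) (fun h => f (jbar h))) ∧
        ‖G.amplitude M a m μ (fun h => f (jφ h)) (fun h => f (jbar h))‖ ≤
          K ^ Fintype.card V *
            ∏ i ∈ Finset.range (Λ + 1), ∏ g ∈ G.highSubgraphs μ i,
              (M : ℝ) ^ G.divergenceDegree g := by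
  classical
  obtain ⟨B, hB1, hB⟩ := (TensorModel.BoundedSmooth.mk hf hfb).mFourierCoeff_le
  obtain ⟨K, c, hK1, hc, hK⟩ := TensorModel.exists_slice_bounds hM ha hm
  have hM0 : (0 : ℝ) < M := by positivity
  have hM1 : (1 : ℝ) ≤ M := by exact_mod_cast (by omega : 1 ≤ M)
  set S : ℝ := max 1 (∑' n : ℤ, ((1 + |(n : ℝ)|) ^ 2)⁻¹) with hS
  have hS0 : 0 < S := lt_of_lt_of_le one_pos (le_max_left _ _)
  have hK0 : 0 < K := by linarith
  have hB0 : 0 < B := by linarith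
  -- Per vertex there are at most two lines, four external legs, six closed faces and six strands
  -- starting at external `φ`-legs; each line loses a further factor `M` to the scale `0`.
  refine ⟨K ^ 2 * B ^ 4 * M ^ 2 * (2 + 2 / c) ^ 6 * S ^ 6, by positivity, ?_⟩
  intro V L _ _ G _ jφ jbar Λ μ hμ
  obtain ⟨ρ, hρ⟩ := G.exists_lowest_line μ
  set P : ℝ := ∏ l, G.lineFactor M μ l with hP
  have hP0 : 0 ≤ P := Finset.prod_nonneg fun l _ => TensorModel.TensorGraph.lineFactor_nonneg M μ l
  obtain ⟨h1, h2⟩ := TensorModel.summable_and_norm_tsum_le_prod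
    (F := G.integrand M a m μ (fun h => f (jφ h)) (fun h => f (jbar h)))
    (TensorModel.TensorGraph.strandMomenta_injOn hρ)
    (w := TensorModel.TensorGraph.strandWeight M c μ ρ)
    (C := K ^ (2 * Fintype.card V) * B ^ (4 * Fintype.card V) * P)
    TensorModel.TensorGraph.strandWeight_nonneg
    (TensorModel.TensorGraph.summable_strandWeight hM hc μ ρ) (by positivity)
    (fun pq h => TensorModel.TensorGraph.integrand_eq_zero h)
    (fun pq h => TensorModel.TensorGraph.norm_integrand_le hM hK1 hc hK hB1
      (fun e n => hB (jφ e) n) (fun e n => hB (jbar e) n) hρ h)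
  refine ⟨h1, h2.trans ?_⟩
  have h3 := TensorModel.TensorGraph.prod_tsum_strandWeight_le hM hc μ ρ
  rw [← hS] at h3
  have h4 := TensorModel.TensorGraph.le_prod_highSubgraphs hM hμ hρ
  set N := Fintype.card V with hN
  set Q : ℝ := ∏ l, ((M : ℝ)⁻¹ ^ (μ l + 1) *
    if G.EndsOnWave l then (M : ℝ) ^ (μ l + 1) else 1) with hQ
  set R : ℝ := ∏ F, (M : ℝ) ^ (μ (ρ F) + 1) with hR
  have hR0 : 0 ≤ R := Finset.prod_nonneg fun _ _ => by positivity
  have hQ0 : 0 ≤ Q := Finset.prod_nonneg fun l _ => by split_ifs <;> positivity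
  have h5 : P ≤ (M : ℝ) ^ (2 * N) * Q := by
    calc P ≤ ∏ l, (M * ((M : ℝ)⁻¹ ^ (μ l + 1) *
          if G.EndsOnWave l then (M : ℝ) ^ (μ l + 1) else 1)) :=
          Finset.prod_le_prod (fun l _ => TensorModel.TensorGraph.lineFactor_nonneg M μ l)
            fun l _ => TensorModel.TensorGraph.lineFactor_le hM μ l
      _ = (M : ℝ) ^ Fintype.card L * Q := by
        rw [Finset.prod_mul_distrib, Finset.prod_const, Finset.card_univ]
      _ ≤ _ := by
        gcongr
        exact G.card_line_le
  calc _ ≤ K ^ (2 * N) * B ^ (4 * N) * ((M : ℝ) ^ (2 * N) * Q) *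
        ((2 + 2 / c) ^ (6 * N) * S ^ (6 * N) * R) := by
        exact mul_le_mul (mul_le_mul_of_nonneg_left h5 (by positivity)) h3
          (Finset.prod_nonneg fun r _ =>
            tsum_nonneg (TensorModel.TensorGraph.strandWeight_nonneg _)) (by positivity)
    _ = (K ^ 2 * B ^ 4 * M ^ 2 * (2 + 2 / c) ^ 6 * S ^ 6) ^ N * (Q * R) := by
        simp only [pow_mul, mul_pow]
        ring
    _ ≤ _ := mul_le_mul_of_nonneg_left h4 (by positivity)
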